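/- Let $n\ge 1$ be an integer, $p,q\in(0,1)$ and $\lambda>0$. Write $K_n$ for the complete graph on $[n]=\{1,\dots,n\}$. For a simple graph $G$ on $[n]$ let $$Z_G(z)=\sum_{M} z^{|M|},$$ the sum being over all matchings $M$ of $G$ (sets of pairwise disjoint edges of $G$, including the empty set). For a tuple $(e_1,\dots,e_m)$ of edges of $K_n$, possibly with repetitions, let $H=H(e_1,\dots,e_m)$ be the graph on the vertex set $\{1,\dots,m\}$ in which distinct $i,j$ are adjacent if and only if $e_i\cap e_j\neq\varnothing$, and let $$\phi(H)=\frac1{m!}\sum_{S}(-1)^{|S|},$$ where the sum is over all connected spanning subgraphs $S$ of $H$ and $|S|$ is the number of edges of $S$. In all sums below each $e_i$ ranges over all edges of $K_n$. For a graph $A$ on $[n]$ let $A_e=1$ if $e$ is an edge of $A$ and $A_e=0$ otherwise. Suppose that $\lambda\le\frac1{30n}$ and $\frac{9\log n}{n}\le q\le 1.01\,p$. Then the following hold. (i) The cluster expansion $$\log Z_{K_n}(\lambda)=\sum_{m\ge1}\ \sum_{e_1,\dots,e_m}\phi(H(e_1,\dots,e_m))\,\lambda^m$$ converges absolutely (that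 is, $\sum_{m\ge1}\sum_{e_1,\dots,e_m}|\phi(H(e_1,\dots,e_m))|\,\lambda^m<\infty$) with sum $\log Z_{K_n}(\lambda)$, and $$\Big|\log Z_{K_n}(\lambda)-\sum_{1\le m\le 2\log n}\ \sum_{e_1,\dots,e_m}\phi(H(e_1,\dots,e_m))\,\lambda^m\Big|\le\frac1n .$$ (ii) If $A\sim G(n,q)$ is an Erdős–Rényi random graph, then with probability at least $1-\frac1n$ the following both hold: the cluster expansion $$\log Z_A\Big(\frac\lambda p\Big)=\sum_{m\ge1}\ \sum_{e_1,\dots,e_m}\phi(H(e_1,\dots,e_m))\,\frac{\lambda^m}{p^m}\prod_{j=1}^m A_{e_j}$$ converges absolutely with sum $\log Z_A(\lambda/p)$, and $$\Big|\log Z_A\Big(\frac\lambda p\Big)-\sum_{1\le m\le 2\log n}\ \sum_{e_1,\dots,e_m}\phi(H(e_1,\dots,e_m))\,\frac{\lambda^m}{p^m}\prod_{j=1}^m A_{e_j}\Big|\le\frac1n .$$ -/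

import Mathlib

namespace MonomerDimer

/-- The edge set of the complete graph `K_n` on the vertex set `Fin n`; these are the polymers. -/
abbrev KnEdge (n : ℕ) : Type := (⊤ : SimpleGraph (Fin n)).edgeSet

/-- A set `M` of edges is a matching of `G` if it consists of edges of `G` and no two distinct
edges of `M` have a common endpoint. -/
def IsMatchingOf {n : ℕ} (G : SimpleGraph (Fin n)) (M : Finset (Sym2 (Fin n))) : Prop :=
  (∀ e ∈ M, e ∈ G.edgeSet) ∧ ∀ e ∈ M, ∀ f ∈ M, e ≠ f → ¬ ∃ v, v ∈ e ∧ v ∈ f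

open Classical in
/-- The monomer-dimer partition function `Z_G(z) = ∑_M z ^ |M|`, the sum being over all matchings
`M` of `G` (the empty one included). -/
noncomputable def partitionFunction {n : ℕ} (G : SimpleGraph (Fin n)) (z : ℝ) : ℝ :=
  ∑ M : Finset (Sym2 (Fin n)) with IsMatchingOf G M, z ^ M.card

/-- The incompatibility graph `H(e_1, …, e_m)` of a tuple of edges of `K_n`: its vertices are the
`m` indices, and two distinct indices are joined when the corresponding edges have a common endpoint
(in particular when the two edges are equal). -/
def incompatibilityGraph {n m : ℕ} (e : Fin m → KnEdge n) : SimpleGraph (Fin m) where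
  Adj i j := i ≠ j ∧ ∃ v, v ∈ (e i : Sym2 (Fin n)) ∧ v ∈ (e j : Sym2 (Fin n))
  symm := ⟨fun _ _ h => ⟨h.1.symm, h.2.imp fun _ hv => ⟨hv.2, hv.1⟩⟩⟩
  loopless := ⟨fun _ h => h.1 rfl⟩

open Classical in
/-- The Ursell function `φ(H) = (1 / m!) ∑_S (-1) ^ |S|` of a graph `H` on `m` labelled vertices; the
sum is over the connected spanning subgraphs `S` of `H`, and `|S|` is the number of edges of `S`. -/
noncomputable def ursell {m : ℕ} (H : SimpleGraph (Fin m)) : ℝ :=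
  1 / (m.factorial : ℝ) *
    ∑ S : SimpleGraph (Fin m) with S ≤ H ∧ S.Connected, (-1 : ℝ) ^ S.edgeSet.ncard

open Classical in
/-- The entry `A_e ∈ {0, 1}` of the adjacency matrix of the graph `A`. -/
noncomputable def adjEntry {n : ℕ} (A : SimpleGraph (Fin n)) (e : KnEdge n) : ℝ :=
  if (e : Sym2 (Fin n)) ∈ A.edgeSet then 1 else 0

end MonomerDimer

/-! Matchings of a graph are the sets of pairwise compatible polymers in a polymer gas: the polymers
are the edges of $K_n$, incompatible when they meet, with weight $z A_e$. The logarithm of the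
partition function is then the generating function of connected signed graph sums, and everything
reduces to a Kotecký–Preiss condition together with a weighted bound on the clusters.

Algebra: a spanning subgraph splits into the component of one vertex and the rest
(`spanSum_insert`), and the signed sum of all spanning subgraphs is the indicator of independence
(`spanSum_eq`). Summed over tuples this is the coefficient form of $Z' = L'Z$, so $Z = \exp L$ once
$L$ converges beyond $t = 1$ (`sum_eq_exp_tsum`).

Analysis: deleting a root $x$ from a connected graph and splitting off the block of another vertex
gives a recursion whose terms all carry one explicit sign (`connSum_insert_insert`). Taking absolute
values yields a differential inequality $G_x' \le B_x' G_x$ for the rooted cluster series, with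
$B_x$ built from the series of the neighbours of $x$. Hence $G_x(1) \le e$ as soon as the
neighbourhood weights are at most $1/e$ (`sum_range_le_exp_one`). Asking for $1/e^2$ instead leaves
room for an extra weight $e^m$ on clusters of size $m$, so the tail beyond $N$ is at most
$e^{-(N+1)} e^2 \sum_e w_e$ (`abs_log_sub_le`).

Numbers: if $e^2 z \deg v \le 1/2$ at every vertex, the condition holds since an edge has two
endpoints, and $e^2\sum_e w_e \le n/2$; with $N = \lfloor 2\log n\rfloor$ the tail is at most
$n^{-2}\cdot n/2 \le 1/n$ (`clusterExpansion_of_degree_le`). For $K_n$ this follows from $\lambda n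
\le 1/30$. For $G(n,q)$, a Chernoff bound gives all degrees at most $2nq \le 2.02\,np$ with
probability at least $1 - 1/n$. -/

namespace ClusterExpansion

/-! ### Signed sums over spanning and connected spanning subgraphs. -/

section Graphs

open Classical Finset

variable {V W : Type*}

/-- The edges of `S` with both endpoints in `B`, as a graph on the same vertex set. -/
def within (S : SimpleGraph V) (B : Finset V) : SimpleGraph V where
  Adj a b := S.Adj a b ∧ a ∈ B ∧ b ∈ B
  symm := ⟨fun _ _ h => ⟨h.1.symm, h.2.2, h.2.1⟩⟩
  loopless := ⟨fun _ h => h.1.ne rfl⟩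

lemma within_le (S : SimpleGraph V) (B : Finset V) : within S B ≤ S := fun _ _ h => h.1

lemma support_within_subset (S : SimpleGraph V) (B : Finset V) :
    (within S B).support ⊆ B := by
  rintro a ⟨b, h⟩
  exact h.2.1

lemma mem_of_adj {S : SimpleGraph V} {B : Finset V} (h : S.support ⊆ B) {a b : V}
    (hab : S.Adj a b) : a ∈ B := h ⟨b, hab⟩

lemma within_sup_left {S₁ S₂ : SimpleGraph V} {B₁ B₂ : Finset V} (hB : Disjoint B₁ B₂)
    (h₁ : S₁.support ⊆ B₁) (h₂ : S₂.support ⊆ B₂) : within (S₁ ⊔ S₂) B₁ = S₁ := by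
  ext a b
  constructor
  · rintro ⟨h | h, ha, hb⟩
    · exact h
    · exact absurd (mem_of_adj h₂ h) (Finset.disjoint_left.1 hB ha)
  · intro h
    exact ⟨Or.inl h, mem_of_adj h₁ h, mem_of_adj h₁ h.symm⟩

lemma ncard_edgeSet_sup [Finite V] {S₁ S₂ : SimpleGraph V} {B₁ B₂ : Finset V} (hB : Disjoint B₁ B₂)
    (h₁ : S₁.support ⊆ B₁) (h₂ : S₂.support ⊆ B₂) :
    (S₁ ⊔ S₂).edgeSet.ncard = S₁.edgeSet.ncard + S₂.edgeSet.ncard := by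
  rw [SimpleGraph.edgeSet_sup, Set.ncard_union_eq _ (Set.toFinite _) (Set.toFinite _)]
  rw [Set.disjoint_left]
  intro e
  induction e using Sym2.ind with
  | _ a b =>
    intro h h'
    exact Finset.disjoint_left.1 hB (mem_of_adj h₁ h) (mem_of_adj h₂ h')

/-- The vertices in `U` that are connected to `x` in `S`. -/
noncomputable def reachIn (S : SimpleGraph V) (x : V) (U : Finset V) : Finset V :=
  U.filter (S.Reachable x)

lemma mem_reachIn {S : SimpleGraph V} {x y : V} {U : Finset V} :
    y ∈ reachIn S x U ↔ y ∈ U ∧ S.Reachable x y := by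
  simp [reachIn]

/-- A walk from `x` only visits vertices reachable from `x`, and those with a neighbour lie in the
support, so the walk stays inside the component. -/
lemma reachable_within [DecidableEq V] {S : SimpleGraph V} {x y : V} {U : Finset V}
    (hS : S.support ⊆ (insert x U : Finset V)) (h : S.Reachable x y) :
    (within S (insert x (reachIn S x U))).Reachable x y := by
  have key : ∀ z, S.Reachable x z → z ∈ S.support → z ∈ insert x (reachIn S x U) := by
    intro z hz hs
    have := hS hs
    simp only [coe_insert, Set.mem_insert_iff, mem_coe] at this
    rw [mem_insert, mem_reachIn]
    tauto
  rw [SimpleGraph.reachable_iff_reflTransGen] at h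
  induction h with
  | refl => rfl
  | @tail a b ha hab ih =>
    rw [← SimpleGraph.reachable_iff_reflTransGen] at ha
    refine ih.trans (SimpleGraph.Adj.reachable ?_)
    exact ⟨hab, key a ha ⟨b, hab⟩, key b (ha.trans hab.reachable) ⟨a, hab.symm⟩⟩

lemma within_sup_within [DecidableEq V] {S : SimpleGraph V} {x : V} {U : Finset V}
    (hSU : S.support ⊆ (insert x U : Finset V)) :
    within S (insert x (reachIn S x U)) ⊔ within S (U \ reachIn S x U) = S := by
  refine le_antisymm (sup_le (within_le _ _) (within_le _ _)) ?_
  intro a b hab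
  have ha := mem_of_adj hSU hab
  have hb := mem_of_adj hSU hab.symm
  have hiff : S.Reachable x a ↔ S.Reachable x b :=
    ⟨fun h => h.trans hab.reachable, fun h => h.trans hab.symm.reachable⟩
  have hxx : S.Reachable x x := SimpleGraph.Reachable.refl x
  by_cases hr : S.Reachable x a
  · left
    refine ⟨hab, ?_, ?_⟩ <;> simp only [mem_insert, mem_reachIn] at ha hb ⊢ <;> tauto
  · right
    have hr' := fun h => hr (hiff.2 h)
    have hax : a ≠ x := by rintro rfl; exact hr hxx
    have hbx : b ≠ x := by rintro rfl; exact hr' hxx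
    refine ⟨hab, ?_, ?_⟩ <;> simp only [mem_insert, mem_reachIn, mem_sdiff] at ha hb ⊢ <;> tauto

lemma mem_of_reachable_sup {S₁ S₂ : SimpleGraph V} {B₁ B₂ : Finset V} (hB : Disjoint B₁ B₂)
    (h₁ : S₁.support ⊆ B₁) (h₂ : S₂.support ⊆ B₂) {x y : V} (hx : x ∈ B₁)
    (h : (S₁ ⊔ S₂).Reachable x y) : y ∈ B₁ := by
  rw [SimpleGraph.reachable_iff_reflTransGen] at h
  induction h with
  | refl => exact hx
  | @tail a b ha hab ih =>
    rcases hab with h | h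
    · exact mem_of_adj h₁ h.symm
    · exact absurd (mem_of_adj h₂ h) (Finset.disjoint_left.1 hB ih)

variable [Fintype V] [Fintype W]

/-- The signed count of the spanning subgraphs of `H` restricted to `B`. -/
noncomputable def spanSum (H : SimpleGraph V) (B : Finset V) : ℝ :=
  ∑ S : SimpleGraph V with S ≤ H ∧ S.support ⊆ B, (-1 : ℝ) ^ S.edgeSet.ncard

/-- The signed count of the connected spanning subgraphs of `H` restricted to `B`. -/
noncomputable def connSum (H : SimpleGraph V) (B : Finset V) : ℝ :=
  ∑ S : SimpleGraph V with S ≤ H ∧ S.support ⊆ B ∧ B.Nonempty ∧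
    ∀ x ∈ B, ∀ y ∈ B, S.Reachable x y, (-1 : ℝ) ^ S.edgeSet.ncard

/-- A spanning subgraph is the union of the component of `x` and a spanning subgraph of the
remaining vertices. -/
lemma spanSum_insert [DecidableEq V] (H : SimpleGraph V) {x : V} {U : Finset V} (hx : x ∉ U) :
    spanSum H (insert x U) =
      ∑ B ∈ U.powerset, connSum H (insert x B) * spanSum H (U \ B) := by
  obtain rfl : ‹DecidableEq V› = fun a b => propDecidable (a = b) := Subsingleton.elim _ _
  unfold spanSum
  rw [← Finset.sum_fiberwise_of_maps_to (s := univ.filter _) (t := U.powerset)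
    (g := fun S : SimpleGraph V => reachIn S x U)
    (fun S _ => mem_powerset.2 fun y hy => (mem_reachIn.1 hy).1)]
  refine Finset.sum_congr rfl fun B hB => ?_
  rw [mem_powerset] at hB
  have hdisj : Disjoint (insert x B) (U \ B) := by
    rw [Finset.disjoint_left]
    intro a ha ha'
    simp only [mem_insert, mem_sdiff] at ha ha'
    rcases ha with rfl | ha
    · exact hx ha'.1
    · exact ha'.2 ha
  unfold connSum
  rw [Finset.sum_mul_sum, ← Finset.sum_product']
  -- For a fixed component `insert x B`, no edge of `S` leaves it, so `S` is the same as a connected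
  -- graph on it and an arbitrary graph on the complement.
  refine Finset.sum_nbij' (fun S => (within S (insert x B), within S (U \ B)))
    (fun p => p.1 ⊔ p.2) ?_ ?_ ?_ ?_ ?_
  · intro S hS
    simp only [mem_filter, mem_univ, true_and] at hS
    obtain ⟨⟨hSH, hSU⟩, rfl⟩ := hS
    simp only [mem_product, mem_filter, mem_univ, true_and]
    refine ⟨⟨(within_le _ _).trans hSH, support_within_subset _ _, insert_nonempty _ _, ?_⟩,
      (within_le _ _).trans hSH, support_within_subset _ _⟩
    have key : ∀ y ∈ insert x (reachIn S x U),
        (within S (insert x (reachIn S x U))).Reachable x y := by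
      intro y hy
      refine reachable_within hSU ?_
      rw [mem_insert, mem_reachIn] at hy
      rcases hy with rfl | hy
      · rfl
      · exact hy.2
    exact fun y hy z hz => (key y hy).symm.trans (key z hz)
  · rintro ⟨S₁, S₂⟩ hS
    simp only [mem_product, mem_filter, mem_univ, true_and] at hS
    obtain ⟨⟨h1, h1s, -, h1c⟩, h2, h2s⟩ := hS
    simp only [mem_filter, mem_univ, true_and]
    refine ⟨⟨sup_le h1 h2, ?_⟩, ?_⟩
    · rintro a ⟨b, hab | hab⟩
      · exact Finset.insert_subset_insert _ hB (mem_of_adj h1s hab)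
      · exact mem_insert_of_mem (mem_sdiff.1 (mem_of_adj h2s hab)).1
    · ext y
      rw [mem_reachIn]
      constructor
      · rintro ⟨hy, hr⟩
        have := mem_of_reachable_sup hdisj h1s h2s (mem_insert_self _ _) hr
        rcases mem_insert.1 this with rfl | h
        · exact absurd hy hx
        · exact h
      · intro hy
        exact ⟨hB hy, (h1c x (mem_insert_self _ _) y (mem_insert_of_mem hy)).mono le_sup_left⟩
  · intro S hS
    simp only [mem_filter, mem_univ, true_and] at hS
    obtain ⟨⟨hSH, hSU⟩, rfl⟩ := hS
    exact within_sup_within hSU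
  · rintro ⟨S₁, S₂⟩ hS
    simp only [mem_product, mem_filter, mem_univ, true_and] at hS
    obtain ⟨⟨h1, h1s, -, h1c⟩, h2, h2s⟩ := hS
    refine Prod.ext (within_sup_left hdisj h1s h2s) ?_
    change within (S₁ ⊔ S₂) (U \ B) = S₂
    rw [sup_comm]
    exact within_sup_left hdisj.symm h2s h1s
  · intro S hS
    simp only [mem_filter, mem_univ, true_and] at hS
    obtain ⟨⟨hSH, hSU⟩, rfl⟩ := hS
    rw [← pow_add, ← ncard_edgeSet_sup hdisj (support_within_subset _ _)
      (support_within_subset _ _)]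
    rw [within_sup_within hSU]

/-- Summation over the subgraphs of `H` is summation over the sets of edges of `H`. -/
lemma sum_le_eq_sum_powerset {M : Type*} [AddCommMonoid M] (H : SimpleGraph V)
    (g : Finset (Sym2 V) → M) :
    ∑ S : SimpleGraph V with S ≤ H, g S.edgeFinset = ∑ T ∈ H.edgeFinset.powerset, g T := by
  refine Finset.sum_nbij' (fun S => S.edgeFinset)
    (fun T => SimpleGraph.fromEdgeSet (T : Set (Sym2 V))) ?_ ?_ ?_ ?_ ?_
  · intro S hS
    simpa using hS
  · intro T hT
    simp only [mem_filter, mem_univ, true_and]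
    rw [mem_powerset] at hT
    intro a b hab
    rw [SimpleGraph.fromEdgeSet_adj] at hab
    have := hT hab.1
    simpa using this
  · intro S hS
    simp
  · intro T hT
    rw [mem_powerset] at hT
    ext e
    simp only [SimpleGraph.mem_edgeFinset, SimpleGraph.edgeSet_fromEdgeSet, Set.mem_sdiff, mem_coe]
    constructor
    · exact fun h => h.1
    · intro h
      refine ⟨h, ?_⟩
      have := hT h
      rw [SimpleGraph.mem_edgeFinset] at this
      exact H.not_isDiag_of_mem_edgeSet this
  · intro S hS
    rfl

/-- An alternating sum over all subsets of an edge set vanishes unless that edge set is empty. -/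
lemma spanSum_eq (H : SimpleGraph V) (U : Finset V) :
    spanSum H U = if ∀ a ∈ U, ∀ b ∈ U, ¬ H.Adj a b then 1 else 0 := by
  have h1 : spanSum H U = ∑ S : SimpleGraph V with S ≤ within H U, (-1 : ℝ) ^ #S.edgeFinset := by
    unfold spanSum
    refine Finset.sum_congr ?_ fun S _ => ?_
    · ext S
      simp only [mem_filter, mem_univ, true_and]
      constructor
      · rintro ⟨h, hs⟩ a b hab
        exact ⟨h hab, mem_of_adj hs hab, mem_of_adj hs hab.symm⟩
      · intro h
        exact ⟨h.trans (within_le _ _), (SimpleGraph.support_mono h).trans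
          (support_within_subset _ _)⟩
    · rw [← SimpleGraph.coe_edgeFinset, Set.ncard_coe_finset]
  rw [h1, sum_le_eq_sum_powerset (within H U) (fun T => (-1 : ℝ) ^ #T)]
  have h2 := Finset.sum_powerset_neg_one_pow_card (x := (within H U).edgeFinset)
  have h3 : ∑ T ∈ (within H U).edgeFinset.powerset, (-1 : ℝ) ^ #T =
      ((∑ T ∈ (within H U).edgeFinset.powerset, (-1 : ℤ) ^ #T : ℤ) : ℝ) := by
    push_cast; rfl
  rw [h3, h2]
  have h4 : (within H U).edgeFinset = ∅ ↔ ∀ a ∈ U, ∀ b ∈ U, ¬ H.Adj a b := by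
    rw [SimpleGraph.edgeFinset_eq_empty]
    constructor
    · intro h a ha b hb hab
      have : (within H U).Adj a b := ⟨hab, ha, hb⟩
      rw [h] at this
      exact this
    · intro h
      ext a b
      simp only [SimpleGraph.bot_adj, iff_false]
      exact fun hab => h a hab.2.1 b hab.2.2 hab.1
  simp only [h4]
  split_ifs <;> simp

lemma spanSum_insert_eq_mul [DecidableEq V] (H : SimpleGraph V) {x : V} (U : Finset V) :
    spanSum H (insert x U) = spanSum H U * if ∀ u ∈ U, ¬ H.Adj x u then 1 else 0 := by
  rw [spanSum_eq, spanSum_eq]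
  by_cases h : ∀ u ∈ U, ¬ H.Adj x u
  · rw [if_pos h, mul_one]
    congr 1
    simp only [mem_insert, forall_eq_or_imp, SimpleGraph.irrefl, not_false_eq_true, true_and,
      eq_iff_iff]
    constructor
    · exact fun h' a ha b hb => (h'.2 a ha).2 b hb
    · exact fun h' => ⟨h, fun a ha => ⟨fun hh => h a ha hh.symm, h' a ha⟩⟩
  · rw [if_neg h, mul_zero, if_neg]
    intro h'
    exact h fun u hu => h' x (mem_insert_self _ _) u (mem_insert_of_mem hu)

/-- Relabelling invariance: it lets sums over a block of indices be read as sums over tuples indexed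
by that block. -/
lemma connSum_map (H : SimpleGraph W) (φ : V ↪ W) (B : Finset V) :
    connSum H (B.map φ) = connSum (H.comap φ) B := by
  unfold connSum
  symm
  have hcm : ∀ S : SimpleGraph W, S.support ⊆ (B.map φ : Finset W) → (S.comap φ).map φ = S := by
    intro S hS
    refine le_antisymm (SimpleGraph.map_comap_le φ S) ?_
    intro a b hab
    have ha := mem_of_adj hS hab
    have hb := mem_of_adj hS hab.symm
    rw [mem_map] at ha hb
    obtain ⟨a, ha, rfl⟩ := ha
    obtain ⟨b, hb, rfl⟩ := hb
    rw [SimpleGraph.map_adj]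
    exact ⟨a, b, hab, rfl, rfl⟩
  have hreach : ∀ S : SimpleGraph W, S.support ⊆ (B.map φ : Finset W) → ∀ x y,
      S.Reachable (φ x) y → ∀ z, φ z = y → (S.comap φ).Reachable x z := by
    intro S hS x y h
    rw [SimpleGraph.reachable_iff_reflTransGen] at h
    induction h with
    | refl =>
      intro z hz
      rw [φ.injective hz]
    | @tail a b ha hab ih =>
      rintro z rfl
      have ha := mem_of_adj hS hab
      rw [mem_map] at ha
      obtain ⟨a, ha, rfl⟩ := ha
      exact (ih a rfl).trans (SimpleGraph.Adj.reachable (by simpa using hab))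
  refine Finset.sum_nbij' (fun S => S.map φ) (fun S => S.comap φ) ?_ ?_ ?_ ?_ ?_
  · intro S hS
    simp only [mem_filter, mem_univ, true_and] at hS ⊢
    obtain ⟨h1, h2, h3, h4⟩ := hS
    refine ⟨(SimpleGraph.map_le_iff_le_comap _ _ _).2 h1, ?_, by simpa using h3, ?_⟩
    · rw [SimpleGraph.support_map]
      rw [coe_map]
      exact Set.image_mono h2
    · intro x hx y hy
      rw [mem_map] at hx hy
      obtain ⟨x, hx, rfl⟩ := hx
      obtain ⟨y, hy, rfl⟩ := hy
      exact (h4 x hx y hy).map (SimpleGraph.Embedding.map φ S).toHom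
  · intro S hS
    simp only [mem_filter, mem_univ, true_and] at hS ⊢
    obtain ⟨h1, h2, h3, h4⟩ := hS
    refine ⟨SimpleGraph.comap_monotone φ h1, ?_, by simpa using h3, ?_⟩
    · rintro a ⟨b, hab⟩
      have := mem_of_adj h2 hab
      simpa using this
    · intro x hx y hy
      exact hreach S h2 x _ (h4 _ (mem_map_of_mem φ hx) _ (mem_map_of_mem φ hy)) y rfl
  · intro S hS
    exact SimpleGraph.comap_map_eq φ S
  · intro S hS
    simp only [mem_filter, mem_univ, true_and] at hS
    exact hcm S hS.2.1
  · intro S hS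
    rw [SimpleGraph.edgeSet_map, Set.ncard_image_of_injective _ φ.sym2Map.injective]

lemma connSum_comap_equiv (H : SimpleGraph W) (φ : V ≃ W) :
    connSum (H.comap φ) univ = connSum H univ := by
  have := connSum_map H φ.toEmbedding univ
  rw [Finset.map_univ_equiv] at this
  exact this.symm

lemma connSum_comap_coe (H : SimpleGraph V) (B : Finset V) :
    connSum (H.comap ((↑) : B → V)) univ = connSum H B := by
  have := connSum_map H (Function.Embedding.subtype (· ∈ B)) univ
  have h2 : (univ : Finset {x // x ∈ B}).map (Function.Embedding.subtype (· ∈ B)) = B := by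
    ext a; simp
  rw [h2] at this
  rw [this]
  rfl

end Graphs

lemma ursell_eq {m : ℕ} (H : SimpleGraph (Fin m)) :
    MonomerDimer.ursell H = connSum H Finset.univ / (m.factorial : ℝ) := by
  unfold MonomerDimer.ursell connSum
  rw [one_div, inv_mul_eq_div]
  congr 1
  -- The clause `B.Nonempty` in `connSum` matches the nonemptiness in `Connected`, so both sums are
  -- empty when `m = 0`.
  refine Finset.sum_congr ?_ fun _ _ => rfl
  ext S
  simp only [Finset.mem_filter, Finset.mem_univ, true_and, Finset.coe_univ, Set.subset_univ,
    true_implies, SimpleGraph.connected_iff, SimpleGraph.Preconnected, Finset.univ_nonempty_iff]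
  tauto

/-! ### Subset convolution and the root-deletion recursion. -/

section Convolution

open Classical Finset

variable {V : Type*} [DecidableEq V]

/-- The subset convolution of two set functions. -/
noncomputable def conv (g h : Finset V → ℝ) (U : Finset V) : ℝ :=
  ∑ B ∈ U.powerset, g B * h (U \ B)

lemma conv_congr {g g' h h' : Finset V → ℝ} {U : Finset V} (hg : ∀ B ⊆ U, g B = g' B)
    (hh : ∀ B ⊆ U, h B = h' B) : conv g h U = conv g' h' U := by
  refine Finset.sum_congr rfl fun B hB => ?_
  rw [hg B (mem_powerset.1 hB), hh _ sdiff_subset]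

lemma conv_assoc (a b c : Finset V → ℝ) (U : Finset V) :
    conv (conv a b) c U = conv a (conv b c) U := by
  unfold conv
  simp_rw [Finset.sum_mul, Finset.mul_sum]
  rw [Finset.sum_sigma', Finset.sum_sigma']
  refine Finset.sum_bij' (fun p _ => (⟨p.2, p.1 \ p.2⟩ : Σ _ : Finset V, Finset V))
    (fun p _ => (⟨p.1 ∪ p.2, p.1⟩ : Σ _ : Finset V, Finset V)) ?_ ?_ ?_ ?_ ?_
  · rintro ⟨A, B⟩ h
    simp only [mem_sigma, mem_powerset] at h ⊢
    exact ⟨h.2.trans h.1, sdiff_subset_sdiff h.1 subset_rfl⟩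
  · rintro ⟨A, B⟩ h
    simp only [mem_sigma, mem_powerset] at h ⊢
    exact ⟨union_subset h.1 (h.2.trans sdiff_subset), subset_union_left⟩
  · rintro ⟨A, B⟩ h
    simp only [mem_sigma, mem_powerset] at h ⊢
    rw [union_sdiff_of_subset h.2]
  · rintro ⟨A, B⟩ h
    simp only [mem_sigma, mem_powerset] at h ⊢
    congr
    ext x
    have := @h.2 x
    simp only [mem_sdiff, mem_union] at this ⊢
    tauto
  · rintro ⟨A, B⟩ h
    simp only [mem_sigma, mem_powerset] at h ⊢
    have : U \ A = (U \ B) \ (A \ B) := by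
      ext x
      have := @h.2 x
      simp only [mem_sdiff] at this ⊢
      tauto
    rw [this, mul_assoc]

/-- The new element lies in exactly one of the two blocks: shifting by `u` is a derivation for
convolution. -/
lemma conv_insert (g h : Finset V → ℝ) {u : V} {U : Finset V} (hu : u ∉ U) :
    conv g h (insert u U) =
      conv (fun B => g (insert u B)) h U + conv g (fun B => h (insert u B)) U := by
  unfold conv
  rw [Finset.sum_powerset_insert hu, add_comm]
  congr 1
  · refine Finset.sum_congr rfl fun B hB => ?_
    rw [insert_sdiff_insert, sdiff_insert_of_notMem hu]
  · refine Finset.sum_congr rfl fun B hB => ?_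
    rw [insert_sdiff_of_notMem _ fun h => hu (mem_powerset.1 hB h)]

/-- Since `f ∅ = 1`, the term `B = U` isolates `a U`, and induction matches all the others: `f` is
cancellable. -/
lemma eq_of_conv_eq {a b f : Finset V → ℝ} (hf : f ∅ = 1) (U : Finset V)
    (h : ∀ B ⊆ U, conv a f B = conv b f B) : a U = b U := by
  induction U using Finset.strongInduction with
  | H U ih =>
    have hU := h U subset_rfl
    unfold conv at hU
    rw [← Finset.sum_erase_add _ _ (mem_powerset_self U),
      ← Finset.sum_erase_add _ _ (mem_powerset_self U)] at hU
    have : ∑ B ∈ U.powerset.erase U, a B * f (U \ B) =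
        ∑ B ∈ U.powerset.erase U, b B * f (U \ B) := by
      refine Finset.sum_congr rfl fun B hB => ?_
      rw [mem_erase, mem_powerset] at hB
      rw [ih B (hB.2.ssubset_of_ne hB.1) fun C hC => h C (hC.trans hB.2)]
    rw [this] at hU
    rw [Finset.sdiff_self, hf] at hU
    linarith

variable [Fintype V]

/-- Recursion for the connected sums rooted at `x`, obtained by splitting off the block of `u`
when the root is removed. -/
lemma connSum_insert_insert (H : SimpleGraph V) {x u : V} {U : Finset V} (hx : x ∉ U)
    (hu : u ∉ U) (hxu : x ≠ u) :
    connSum H (insert x (insert u U)) =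
      -∑ B ∈ U.powerset, (if ∃ b ∈ insert u B, H.Adj x b then connSum H (insert u B) else 0) *
        connSum H (insert x (U \ B)) := by
  set f := spanSum H with hfdef
  set χ : Finset V → ℝ := fun B => if ∀ b ∈ B, ¬ H.Adj x b then 1 else 0 with hχ
  set K : Finset V → ℝ := fun B => connSum H (insert x B) with hK
  set D : Finset V → ℝ := fun B => connSum H (insert u B) with hD
  set Dχ : Finset V → ℝ := fun B => D B * χ (insert u B) with hDχ
  have hf0 : f ∅ = 1 := by rw [hfdef, spanSum_eq]; simp
  have hχu : ∀ A B, χ (A ∪ B) = χ A * χ B := by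
    intro A B
    simp only [hχ, mem_union, or_imp, forall_and]
    split_ifs <;> simp_all
  have hKf : ∀ B, x ∉ B → conv K f B = f B * χ B := fun B hB => by
    rw [← spanSum_insert_eq_mul, spanSum_insert H hB]; rfl
  have hDf : ∀ B, u ∉ B → conv D f B = f (insert u B) := fun B hB => (spanSum_insert H hB).symm
  -- The factor `Dχ - D` counts the nonempty sets of edges from `x` to the block of `u`: all sets
  -- contribute `χ`, and the empty set removes 1. The identity is checked after convolving with `f`,
  -- where `K` becomes `f * χ` and `D` becomes the shift of `f` by `u`; `f` is then cancelled.
  have main : ∀ B ⊆ U, conv (fun B => K (insert u B)) f B =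
      conv (fun B => conv (fun A => Dχ A - D A) K B) f B := by
    intro B hB
    have hxB : x ∉ B := fun h => hx (hB h)
    have huB : u ∉ B := fun h => hu (hB h)
    have e1 := conv_insert K f huB
    rw [hKf _ (by simp [hxu, hxB])] at e1
    have e2 : conv K (fun A => f (insert u A)) B = conv D (conv K f) B := by
      -- Associativity and commutativity of convolution turn `K * (D * f)` into `D * (K * f)`.
      rw [conv_congr (fun _ _ => rfl) fun A hA => (hDf A fun h => huB (hA h)).symm, ← conv_assoc,
        ← conv_assoc]
      refine conv_congr (fun A _ => ?_) fun _ _ => rfl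
      unfold conv
      refine Finset.sum_nbij' (fun S => A \ S) (fun S => A \ S) ?_ ?_ ?_ ?_ ?_
      · intro S _; simp
      · intro S _; simp
      · intro S hS; simpa using hS
      · intro S hS; simpa using hS
      · intro S hS
        rw [mem_powerset] at hS
        rw [Finset.sdiff_sdiff_eq_self hS, mul_comm]
    have e3 : f (insert u B) * χ (insert u B) = conv Dχ (conv K f) B := by
      rw [← hDf B huB]
      unfold conv
      rw [Finset.sum_mul]
      refine Finset.sum_congr rfl fun A hA => ?_
      rw [mem_powerset] at hA
      have := hKf (B \ A) fun h => hxB (sdiff_subset h)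
      unfold conv at this
      rw [this]
      have h2 : insert u B = insert u A ∪ (B \ A) := by
        rw [insert_union, union_sdiff_of_subset hA]
      rw [h2, hχu, hDχ]
      ring
    have e4 : conv (fun B => conv (fun A => Dχ A - D A) K B) f B =
        conv Dχ (conv K f) B - conv D (conv K f) B := by
      rw [conv_assoc (fun A => Dχ A - D A) K f B]
      unfold conv
      rw [← Finset.sum_sub_distrib]
      refine Finset.sum_congr rfl fun A _ => ?_
      ring
    rw [e4, ← e3, ← e2, e1]
    ring
  rw [show connSum H (insert x (insert u U)) = K (insert u U) from rfl,
    eq_of_conv_eq hf0 U main]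
  unfold conv
  rw [← Finset.sum_neg_distrib]
  refine Finset.sum_congr rfl fun B _ => ?_
  rw [← neg_mul]
  congr 1
  simp only [hDχ, hχ]
  by_cases h : ∃ b ∈ insert u B, H.Adj x b
  · rw [if_pos h, if_neg (by push Not; exact h)]
    ring
  · rw [if_neg h, if_pos (by push Not at h; exact h)]
    ring

end Convolution

/-! ### Sums over tuples of polymers and their recursions. -/

section Tuples

open Classical Finset

variable {P ι κ : Type*}

/-- The incompatibility graph of a tuple of polymers for the incompatibility relation `r`. -/
def overlapGraph (r : P → P → Prop) (e : ι → P) : SimpleGraph ι :=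
  SimpleGraph.fromRel fun i j => r (e i) (e j)

lemma overlapGraph_adj {r : P → P → Prop} (hr : ∀ a b, r a b → r b a) {e : ι → P} {i j : ι} :
    (overlapGraph r e).Adj i j ↔ i ≠ j ∧ r (e i) (e j) := by
  simp only [overlapGraph, SimpleGraph.fromRel_adj]
  have := hr (e j) (e i)
  tauto

lemma overlapGraph_comap (r : P → P → Prop) (e : ι → P) {φ : κ → ι}
    (hφ : Function.Injective φ) : (overlapGraph r e).comap φ = overlapGraph r (e ∘ φ) := by
  ext a b
  simp [overlapGraph, SimpleGraph.fromRel_adj, hφ.ne_iff]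

/-- The tuple obtained by adding `x` to the tuple `e`. -/
def addRoot (x : P) (e : ι → P) : Option ι → P := fun o => o.elim x e

variable [Fintype ι] [Fintype κ] (r : P → P → Prop)

/-- The signed count of connected spanning subgraphs of the incompatibility graph of `e`. -/
noncomputable def mayer (e : ι → P) : ℝ := connSum (overlapGraph r e) univ

/-- `|mayer r e|` if some polymer of `e` is incompatible with `x`, and `0` otherwise. -/
noncomputable def touchWeight (x : P) (e : ι → P) : ℝ :=
  if ∃ i, r x (e i) then |mayer r e| else 0

lemma mayer_comp_equiv (e : ι → P) (σ : κ ≃ ι) : mayer r (e ∘ σ) = mayer r e := by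
  unfold mayer
  rw [← overlapGraph_comap r e σ.injective, connSum_comap_equiv]

lemma connSum_overlapGraph (e : ι → P) (B : Finset ι) :
    connSum (overlapGraph r e) B = mayer r fun i : B => e i := by
  rw [← connSum_comap_coe, overlapGraph_comap _ _ Subtype.val_injective]
  rfl

lemma spanSum_overlapGraph (e : ι → P) (B : Finset ι) :
    spanSum (overlapGraph r e) B = spanSum (overlapGraph r fun i : B => e i) univ := by
  rw [spanSum_eq, spanSum_eq]
  congr 1
  simp [overlapGraph, SimpleGraph.fromRel_adj]

lemma connSum_addRoot_map_some (x : P) (e : ι → P) (B : Finset ι) :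
    connSum (overlapGraph r (addRoot x e)) (B.map Function.Embedding.some) =
      mayer r fun i : B => e i := by
  rw [connSum_map, overlapGraph_comap _ _ Function.Embedding.some.injective, ← connSum_overlapGraph]
  rfl

lemma connSum_addRoot_insert_none [DecidableEq ι] (x : P) (e : ι → P) (B : Finset ι) :
    connSum (overlapGraph r (addRoot x e)) (insert none (B.map Function.Embedding.some)) =
      mayer r (addRoot x fun i : B => e i) := by
  have h := connSum_map (overlapGraph r (addRoot x e))
    (Function.Embedding.subtype (· ∈ B)).optionMap univ
  have h2 : (univ : Finset (Option {i // i ∈ B})).map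
      (Function.Embedding.subtype (· ∈ B)).optionMap =
        insert none (B.map Function.Embedding.some) := by
    ext o
    cases o <;> simp [Option.exists]
  rw [h2] at h
  rw [h, overlapGraph_comap _ _ (Function.Embedding.injective _)]
  unfold mayer
  congr 2
  ext o
  cases o <;> rfl

lemma mayer_addRoot_of_isEmpty [IsEmpty ι] (x : P) (e : ι → P) : mayer r (addRoot x e) = 1 := by
  have h := spanSum_insert (overlapGraph r (addRoot x e)) (notMem_empty none)
  simp only [powerset_empty, sum_singleton] at h
  have h2 : (univ : Finset (Option ι)) = insert none ∅ := by
    ext o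
    cases o with
    | none => simp only [mem_univ, mem_insert_self]
    | some i => exact isEmptyElim i
  rw [mayer, h2]
  rw [spanSum_eq, spanSum_eq] at h
  simpa using h.symm

variable (w : P → ℝ)

lemma prod_addRoot (x : P) (e : ι → P) : ∏ o, w (addRoot x e o) = w x * ∏ i, w (e i) := by
  rw [Fintype.prod_option]
  rfl

variable [DecidableEq ι]

lemma prod_weight_split (e : ι → P) {S T : Finset ι} (hT : ∀ i, i ∈ T ↔ i ∉ S) :
    ∏ i, w (e i) = (∏ i : S, w (e i)) * ∏ i : T, w (e i) := by
  have : T = Sᶜ := by ext i; simp [hT]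
  subst this
  rw [Finset.prod_coe_sort S (fun i => w (e i)), Finset.prod_coe_sort Sᶜ (fun i => w (e i)),
    Finset.prod_mul_prod_compl]

/-- The root-deletion recursion with root `none` and distinguished vertex `some u`. The root is
adjacent to a block exactly when `x` is incompatible with one of its polymers, which is the cutoff
in `touchWeight`. -/
lemma abs_mayer_addRoot_le {r : P → P → Prop} (hr : ∀ a b, r a b → r b a) (x : P) (e : ι → P) (u : ι) :
    |mayer r (addRoot x e)| ≤ ∑ B ∈ (univ.erase u).powerset,
      touchWeight r x (fun i : (insert u B : Finset ι) => e i) *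
      |mayer r (addRoot x fun i : (univ.erase u \ B : Finset ι) => e i)| := by
  set s : ι ↪ Option ι := Function.Embedding.some
  have h := connSum_insert_insert (overlapGraph r (addRoot x e)) (x := none) (u := some u)
    (U := (univ.erase u).map s) (by simp [s]) (by simp [s]) (by simp)
  have h1 : insert none (insert (some u) ((univ.erase u).map s)) = univ := by
    ext o
    cases o with
    | none => simp
    | some i => simp [s]
  rw [h1] at h
  rw [mayer, h, abs_neg]
  refine (Finset.abs_sum_le_sum_abs _ _).trans (le_of_eq ?_)
  symm
  refine Finset.sum_bij (fun B _ => B.map s) ?_ ?_ ?_ ?_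
  · intro B hB
    rw [mem_powerset] at hB ⊢
    exact Finset.map_subset_map.2 hB
  · intro A _ B _ hAB
    exact Finset.map_injective s hAB
  · intro B hB
    rw [mem_powerset, Finset.subset_map_iff] at hB
    obtain ⟨A, hA, rfl⟩ := hB
    exact ⟨A, mem_powerset.2 hA, rfl⟩
  · intro B hB
    have h2 : insert (some u) (B.map s) = (insert u B).map s := by
      rw [Finset.map_insert]; rfl
    have h3 : (univ.erase u).map s \ B.map s = (univ.erase u \ B).map s := by
      ext o; cases o <;> simp [s]
    rw [touchWeight, h2, h3, connSum_addRoot_map_some, connSum_addRoot_insert_none, abs_mul]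
    congr 1
    have h4 : (∃ b ∈ (insert u B).map s, (overlapGraph r (addRoot x e)).Adj none b) ↔
        ∃ i : (insert u B : Finset ι), r x (e i) := by
      simp only [overlapGraph_adj hr]
      simp [s, addRoot]
    by_cases h5 : ∃ i : (insert u B : Finset ι), r x (e i)
    · rw [if_pos h5, if_pos (h4.2 h5)]
    · rw [if_neg h5, if_neg (h4.not.2 h5), abs_zero]

variable [Fintype P] [DecidableEq κ]

lemma sum_split {S T : Finset ι} (hT : ∀ i, i ∈ T ↔ i ∉ S) (F : (S → P) → ℝ) (G : (T → P) → ℝ) :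
    ∑ e : ι → P, (F fun i => e i) * (G fun i => e i) * ∏ i, w (e i) =
      (∑ e : S → P, F e * ∏ i, w (e i)) * ∑ e : T → P, G e * ∏ i, w (e i) := by
  rw [Finset.sum_mul_sum, ← Finset.sum_product', Finset.univ_product_univ]
  refine Fintype.sum_equiv
    { toFun := fun e => (fun i : S => e i, fun i : T => e i)
      invFun := fun p i => if h : i ∈ S then p.1 ⟨i, h⟩ else p.2 ⟨i, (hT i).2 h⟩
      left_inv := fun e => by ext i; simp
      right_inv := fun p => by
        refine Prod.ext ?_ ?_
        · ext i; simp
        · ext i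
          have := (hT i).1 i.2
          simp [this] } _ _ fun e => ?_
  simp only [Equiv.coe_fn_mk]
  rw [prod_weight_split w e hT]
  ring

lemma sum_comp_equiv (σ : κ ≃ ι) (F : (κ → P) → ℝ) :
    ∑ e : ι → P, F (e ∘ σ) = ∑ e : κ → P, F e :=
  Fintype.sum_equiv (Equiv.arrowCongr σ (Equiv.refl P)).symm _ _ fun _ => rfl

lemma sum_option (F : (Option ι → P) → ℝ) :
    ∑ e : Option ι → P, F e = ∑ y, ∑ e : ι → P, F (addRoot y e) := by
  rw [← Finset.sum_product', Finset.univ_product_univ]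
  refine Fintype.sum_equiv
    { toFun := fun e => (e none, fun i => e (some i))
      invFun := fun p => addRoot p.1 p.2
      left_inv := fun e => by ext o; cases o <;> rfl
      right_inv := fun p => rfl } _ _ fun e => ?_
  congr 1
  ext o; cases o <;> rfl

/-- `m!` times the `m`-th coefficient of the logarithm of the partition function, summing over
tuples indexed by a type with `m` elements. -/
noncomputable def mayerSum (ι : Type*) [Fintype ι] [DecidableEq ι] : ℝ := ∑ e : ι → P, mayer r e * ∏ i, w (e i)

/-- The sum of the weights of the tuples of pairwise compatible polymers. -/
noncomputable def freeSum (ι : Type*) [Fintype ι] [DecidableEq ι] : ℝ :=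
  ∑ e : ι → P, spanSum (overlapGraph r e) univ * ∏ i, w (e i)

/-- The absolute sum over the clusters rooted at `x`. -/
noncomputable def rootedSum (x : P) (ι : Type*) [Fintype ι] [DecidableEq ι] : ℝ :=
  ∑ e : ι → P, |mayer r (addRoot x e)| * ∏ i, w (e i)

/-- The absolute sum over the clusters that are incompatible with `x`. -/
noncomputable def touchSum (x : P) (ι : Type*) [Fintype ι] [DecidableEq ι] : ℝ :=
  ∑ e : ι → P, touchWeight r x e * ∏ i, w (e i)

lemma mayerSum_congr (σ : κ ≃ ι) : mayerSum r w ι = mayerSum r w κ := by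
  unfold mayerSum
  rw [← sum_comp_equiv σ]
  refine Finset.sum_congr rfl fun e _ => ?_
  rw [mayer_comp_equiv]
  simp only [Function.comp]
  rw [Equiv.prod_comp σ fun i => w (e i)]

lemma freeSum_congr (σ : κ ≃ ι) : freeSum r w ι = freeSum r w κ := by
  unfold freeSum
  rw [← sum_comp_equiv σ]
  refine Finset.sum_congr rfl fun e _ => ?_
  simp only [Function.comp]
  rw [Equiv.prod_comp σ fun i => w (e i), spanSum_eq, spanSum_eq]
  congr 2
  simp [overlapGraph, SimpleGraph.fromRel_adj, σ.forall_congr_left]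

lemma rootedSum_congr (x : P) (σ : κ ≃ ι) : rootedSum r w x ι = rootedSum r w x κ := by
  unfold rootedSum
  rw [← sum_comp_equiv σ]
  refine Finset.sum_congr rfl fun e _ => ?_
  have : addRoot x (e ∘ σ) = addRoot x e ∘ σ.optionCongr := by
    ext o; cases o <;> rfl
  rw [this, mayer_comp_equiv]
  simp only [Function.comp]
  rw [Equiv.prod_comp σ fun i => w (e i)]

lemma touchSum_congr (x : P) (σ : κ ≃ ι) : touchSum r w x ι = touchSum r w x κ := by
  unfold touchSum
  rw [← sum_comp_equiv σ]
  refine Finset.sum_congr rfl fun e _ => ?_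
  rw [touchWeight, touchWeight, mayer_comp_equiv]
  simp only [Function.comp]
  rw [Equiv.prod_comp σ fun i => w (e i)]
  congr 2
  exact propext ⟨fun ⟨i, hi⟩ => ⟨σ.symm i, by simpa using hi⟩, fun ⟨i, hi⟩ => ⟨σ i, hi⟩⟩

lemma mem_sdiff_erase_iff {u : ι} {B : Finset ι} (i : ι) :
    i ∈ univ.erase u \ B ↔ i ∉ insert u B := by
  simp

lemma freeSum_eq_sum_powerset (u : ι) :
    freeSum r w ι = ∑ B ∈ (univ.erase u).powerset,
      mayerSum r w (insert u B : Finset ι) * freeSum r w (univ.erase u \ B : Finset ι) := by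
  have : ∀ e : ι → P, spanSum (overlapGraph r e) univ * ∏ i, w (e i) =
      ∑ B ∈ (univ.erase u).powerset,
        mayer r (fun i : (insert u B : Finset ι) => e i) *
          spanSum (overlapGraph r fun i : (univ.erase u \ B : Finset ι) => e i) univ *
            ∏ i, w (e i) := by
    intro e
    have h := spanSum_insert (overlapGraph r e) (notMem_erase u univ)
    rw [Finset.insert_erase (mem_univ u)] at h
    rw [h, Finset.sum_mul]
    refine Finset.sum_congr rfl fun B _ => ?_
    rw [connSum_overlapGraph, spanSum_overlapGraph]
  rw [freeSum, Finset.sum_congr rfl fun e _ => this e, Finset.sum_comm]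
  refine Finset.sum_congr rfl fun B _ => ?_
  exact sum_split w mem_sdiff_erase_iff (mayer r)
    (fun e => spanSum (overlapGraph r e) univ)

variable {r w}

lemma rootedSum_le_sum_powerset (hr : ∀ a b, r a b → r b a) (hw : ∀ x, 0 ≤ w x) (x : P) (u : ι) :
    rootedSum r w x ι ≤ ∑ B ∈ (univ.erase u).powerset,
      touchSum r w x (insert u B : Finset ι) *
        rootedSum r w x (univ.erase u \ B : Finset ι) := by
  have : ∀ e : ι → P, |mayer r (addRoot x e)| * ∏ i, w (e i) ≤
      ∑ B ∈ (univ.erase u).powerset,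
        touchWeight r x (fun i : (insert u B : Finset ι) => e i) *
          |mayer r (addRoot x fun i : (univ.erase u \ B : Finset ι) => e i)| *
            ∏ i, w (e i) := by
    intro e
    rw [← Finset.sum_mul]
    exact mul_le_mul_of_nonneg_right (abs_mayer_addRoot_le hr x e u)
      (Finset.prod_nonneg fun i _ => hw _)
  refine (Finset.sum_le_sum fun e _ => this e).trans (le_of_eq ?_)
  rw [Finset.sum_comm]
  refine Finset.sum_congr rfl fun B _ => ?_
  exact sum_split w mem_sdiff_erase_iff
    (touchWeight r x) (fun e => |mayer r (addRoot x e)|)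

variable (r w)

/-- The component of index 0 has `j` further members, chosen among `k`. After division by `k!` this
is the coefficient form of $Z' = L'Z$. -/
lemma freeSum_succ (k : ℕ) :
    freeSum r w (Fin (k + 1)) = ∑ j ∈ range (k + 1),
      (k.choose j : ℝ) * (mayerSum r w (Fin (j + 1)) * freeSum r w (Fin (k - j))) := by
  have hc : #(univ.erase (0 : Fin (k + 1))) = k := by simp
  rw [freeSum_eq_sum_powerset r w (0 : Fin (k + 1))]
  have := Finset.sum_powerset_apply_card
    (fun j => mayerSum r w (Fin (j + 1)) * freeSum r w (Fin (k - j)))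
    (x := univ.erase (0 : Fin (k + 1)))
  simp only [hc, nsmul_eq_mul] at this
  rw [← this]
  refine Finset.sum_congr rfl fun B hB => ?_
  rw [mem_powerset] at hB
  have h0 : (0 : Fin (k + 1)) ∉ B := fun h => by simpa using hB h
  congr 1
  · exact mayerSum_congr r w (Fintype.equivOfCardEq
      (by rw [Fintype.card_fin, Fintype.card_coe, card_insert_of_notMem h0]))
  · refine freeSum_congr r w (Fintype.equivOfCardEq ?_)
    rw [Fintype.card_fin, Fintype.card_coe, card_sdiff_of_subset hB, hc]

/-- The same count of blocks, applied to the root-deletion inequality; it is the coefficient form of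
a differential inequality for the rooted series. -/
lemma rootedSum_succ_le (hr : ∀ a b, r a b → r b a) (hw : ∀ x, 0 ≤ w x) (x : P) (k : ℕ) :
    rootedSum r w x (Fin (k + 1)) ≤ ∑ j ∈ range (k + 1),
      (k.choose j : ℝ) * (touchSum r w x (Fin (j + 1)) * rootedSum r w x (Fin (k - j))) := by
  have hc : #(univ.erase (0 : Fin (k + 1))) = k := by simp
  refine (rootedSum_le_sum_powerset hr hw x (0 : Fin (k + 1))).trans (le_of_eq ?_)
  have := Finset.sum_powerset_apply_card
    (fun j => touchSum r w x (Fin (j + 1)) * rootedSum r w x (Fin (k - j)))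
    (x := univ.erase (0 : Fin (k + 1)))
  simp only [hc, nsmul_eq_mul] at this
  rw [← this]
  refine Finset.sum_congr rfl fun B hB => ?_
  rw [mem_powerset] at hB
  have h0 : (0 : Fin (k + 1)) ∉ B := fun h => by simpa using hB h
  congr 1
  · exact touchSum_congr r w x (Fintype.equivOfCardEq
      (by rw [Fintype.card_fin, Fintype.card_coe, card_insert_of_notMem h0]))
  · refine rootedSum_congr r w x (Fintype.equivOfCardEq ?_)
    rw [Fintype.card_fin, Fintype.card_coe, card_sdiff_of_subset hB, hc]

/-- Any index can serve as the root, because `mayer` is invariant under relabelling. -/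
lemma sum_pinned (k : ℕ) (i : Fin (k + 1)) (g : P → ℝ) :
    ∑ e : Fin (k + 1) → P, g (e i) * (|mayer r e| * ∏ j, w (e j)) =
      ∑ y, g y * (w y * rootedSum r w y (Fin k)) := by
  have h := sum_comp_equiv (finSuccEquiv' i).symm
    (fun e : Option (Fin k) → P => g (e none) * (|mayer r e| * ∏ j, w (e j)))
  have h2 : ∀ e : Fin (k + 1) → P, g (e i) * (|mayer r e| * ∏ j, w (e j)) =
      g ((e ∘ (finSuccEquiv' i).symm) none) *
        (|mayer r (e ∘ (finSuccEquiv' i).symm)| * ∏ j, w ((e ∘ (finSuccEquiv' i).symm) j)) := by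
    intro e
    rw [mayer_comp_equiv]
    simp only [Function.comp, finSuccEquiv'_symm_none]
    rw [Equiv.prod_comp (finSuccEquiv' i).symm fun i => w (e i)]
  rw [Finset.sum_congr rfl fun e _ => h2 e]
  rw [h]
  rw [sum_option]
  refine Finset.sum_congr rfl fun y _ => ?_
  rw [rootedSum, Finset.mul_sum, Finset.mul_sum]
  refine Finset.sum_congr rfl fun e _ => ?_
  rw [prod_addRoot]
  simp only [addRoot, Option.elim]
  ring

lemma sum_abs_mayer (k : ℕ) :
    ∑ e : Fin (k + 1) → P, |mayer r e| * ∏ j, w (e j) = ∑ y, w y * rootedSum r w y (Fin k) := by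
  simpa using sum_pinned r w k 0 fun _ => 1

/-- A union bound over the `k + 1` positions at which the polymer incompatible with `x` may sit;
that polymer becomes the new root. -/
lemma touchSum_le (hw : ∀ x, 0 ≤ w x) (x : P) (k : ℕ) :
    touchSum r w x (Fin (k + 1)) ≤
      (k + 1) * ∑ y with r x y, w y * rootedSum r w y (Fin k) := by
  have h : ∀ e : Fin (k + 1) → P, touchWeight r x e * ∏ j, w (e j) ≤
      ∑ i, (if r x (e i) then 1 else 0) * (|mayer r e| * ∏ j, w (e j)) := by
    intro e
    have hp : 0 ≤ |mayer r e| * ∏ j, w (e j) :=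
      mul_nonneg (abs_nonneg _) (Finset.prod_nonneg fun i _ => hw _)
    have hnn : ∀ i ∈ univ, 0 ≤ (if r x (e i) then (1 : ℝ) else 0) *
        (|mayer r e| * ∏ j, w (e j)) := fun i _ => by
      split_ifs <;> simp [hp]
    rw [touchWeight]
    split_ifs with hi
    · obtain ⟨i, hi⟩ := hi
      refine le_trans ?_ (Finset.single_le_sum hnn (mem_univ i))
      simp [hi]
    · rw [zero_mul]
      exact Finset.sum_nonneg hnn
  rw [touchSum]
  refine (Finset.sum_le_sum fun e _ => h e).trans (le_of_eq ?_)
  rw [Finset.sum_comm, Finset.sum_congr rfl fun i _ =>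
    sum_pinned r w k i fun y => if r x y then 1 else 0]
  simp [Finset.sum_filter]

lemma rootedSum_zero (x : P) : rootedSum r w x (Fin 0) = 1 := by
  simp [rootedSum, mayer_addRoot_of_isEmpty]

lemma rootedSum_nonneg (hw : ∀ x, 0 ≤ w x) (x : P) : 0 ≤ rootedSum r w x ι :=
  Finset.sum_nonneg fun _ _ => mul_nonneg (abs_nonneg _) (Finset.prod_nonneg fun _ _ => hw _)

end Tuples

/-! ### Convergence of the rooted series by a Grönwall argument. -/

section Convergence

open Classical Finset

/-- A Kotecký–Preiss type bound: a nonnegative family dominated by the exponential of its sums over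
neighbourhoods has partial sums at most `exp 1`. -/
lemma sum_range_le_exp_one {P : Type*} [Fintype P] {r : P → P → Prop} {w : P → ℝ}
    (hw : ∀ x, 0 ≤ w x) {τ : P → ℕ → ℝ} (hτ : ∀ x k, 0 ≤ τ x k) (hτ0 : ∀ x, τ x 0 = 1)
    (hrec : ∀ x k, (k + 1) * τ x (k + 1) ≤
      ∑ j ∈ range (k + 1), (j + 1) * (∑ y with r x y, w y * τ y j) * τ x (k - j))
    (hKP : ∀ x, (∑ y with r x y, w y) * Real.exp 1 ≤ 1) (N : ℕ) (x : P) :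
    ∑ k ∈ range N, τ x k ≤ Real.exp 1 := by
  induction N generalizing x with
  | zero => simpa using (Real.exp_pos 1).le
  | succ N ih =>
    set β : ℕ → ℝ := fun j => ∑ y with r x y, w y * τ y j with hβ
    have hβ0 : ∀ j, 0 ≤ β j := fun j => Finset.sum_nonneg fun y _ => mul_nonneg (hw y) (hτ y j)
    -- `G` is truncated at degree `N`, so its derivative involves `β j` only for `j < N`; this is
    -- what the induction hypothesis controls.
    set G : ℝ → ℝ := fun t => ∑ k ∈ range (N + 1), τ x k * t ^ k with hG
    set G' : ℝ → ℝ := fun t => ∑ k ∈ range N, (k + 1) * τ x (k + 1) * t ^ k with hG'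
    set B : ℝ → ℝ := fun t => ∑ j ∈ range N, β j * t ^ (j + 1) with hB
    set B' : ℝ → ℝ := fun t => ∑ j ∈ range N, (j + 1) * β j * t ^ j with hB'
    have hdG : ∀ t, HasDerivAt G (G' t) t := by
      intro t
      have h : HasDerivAt G (∑ k ∈ range (N + 1), τ x k * (k * t ^ (k - 1))) t :=
        HasDerivAt.fun_sum fun k _ => (hasDerivAt_pow k t).const_mul _
      rw [Finset.sum_range_succ'] at h
      convert h using 1
      simp only [hG', Nat.cast_zero, zero_mul, mul_zero, add_zero, Nat.add_sub_cancel]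
      refine Finset.sum_congr rfl fun k _ => ?_
      push_cast
      ring
    have hdB : ∀ t, HasDerivAt B (B' t) t := by
      intro t
      have h : HasDerivAt B (∑ j ∈ range N, β j * ((j + 1 : ℕ) * t ^ j)) t :=
        HasDerivAt.fun_sum fun k _ => (hasDerivAt_pow (k + 1) t).const_mul _
      convert h using 1
      refine Finset.sum_congr rfl fun k _ => ?_
      push_cast
      ring
    have hineq : ∀ t, 0 ≤ t → G' t ≤ B' t * G t := by
      intro t ht
      have h1 : G' t ≤ ∑ k ∈ range N, ∑ j ∈ range (k + 1),
          ((j + 1) * β j * t ^ j) * (τ x (k - j) * t ^ (k - j)) := by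
        refine Finset.sum_le_sum fun k _ => ?_
        refine (mul_le_mul_of_nonneg_right (hrec x k) (pow_nonneg ht k)).trans (le_of_eq ?_)
        rw [Finset.sum_mul]
        refine Finset.sum_congr rfl fun j hj => ?_
        have hjk : j ≤ k := by simpa [Nat.lt_succ_iff] using hj
        rw [← Nat.add_sub_cancel' hjk, pow_add, Nat.add_sub_cancel' hjk]
        ring
      refine h1.trans ?_
      rw [Finset.sum_range_diag_flip N
        (fun j i => ((j + 1) * β j * t ^ j) * (τ x i * t ^ i)), hB', Finset.sum_mul]
      refine Finset.sum_le_sum fun j _ => ?_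
      rw [← Finset.mul_sum]
      refine mul_le_mul_of_nonneg_left ?_
        (mul_nonneg (mul_nonneg (by positivity) (hβ0 j)) (pow_nonneg ht j))
      refine Finset.sum_le_sum_of_subset_of_nonneg
        (Finset.range_subset_range.2 (by omega)) fun i _ _ => mul_nonneg (hτ x i) (pow_nonneg ht i)
    -- The integrating factor: `G' ≤ B' * G` makes `F` decrease on `[0, 1]`, hence `G 1 ≤ exp (B
    -- 1)`.
    set F : ℝ → ℝ := fun t => G t * Real.exp (-B t) with hF
    have hdF : ∀ t, HasDerivAt F (G' t * Real.exp (-B t) +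
        G t * (Real.exp (-B t) * -B' t)) t := fun t => (hdG t).mul (hdB t).neg.exp
    have hanti : AntitoneOn F (Set.Icc 0 1) := by
      refine antitoneOn_of_deriv_nonpos (convex_Icc 0 1)
        (fun t _ => (hdF t).continuousAt.continuousWithinAt)
        (fun t _ => (hdF t).differentiableAt.differentiableWithinAt) fun t ht => ?_
      rw [interior_Icc] at ht
      rw [(hdF t).deriv]
      have := mul_le_mul_of_nonneg_right (hineq t ht.1.le) (Real.exp_pos (-B t)).le
      linarith
    have h01 := hanti (Set.left_mem_Icc.2 zero_le_one) (Set.right_mem_Icc.2 zero_le_one) zero_le_one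
    have hG0 : G 0 = 1 := by
      simp only [hG]
      rw [Finset.sum_range_succ']
      simp [hτ0]
    have hB0 : B 0 = 0 := by simp [hB]
    -- By induction each neighbour's partial sum is at most `exp 1`, so the smallness hypothesis
    -- closes the loop.
    have hB1 : B 1 ≤ 1 := by
      simp only [hB, hβ, one_pow, mul_one]
      rw [Finset.sum_comm]
      refine le_trans ?_ (hKP x)
      rw [Finset.sum_mul]
      refine Finset.sum_le_sum fun y _ => ?_
      rw [← Finset.mul_sum]
      exact mul_le_mul_of_nonneg_left (ih y) (hw y)
    simp only [hF, hG0, hB0, neg_zero, Real.exp_zero, mul_one] at h01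
    rw [Real.exp_neg, ← div_eq_mul_inv, div_le_one (Real.exp_pos _)] at h01
    have hG1 : G 1 = ∑ k ∈ range (N + 1), τ x k := by simp [hG]
    rw [← hG1]
    exact h01.trans (Real.exp_le_exp.2 hB1)

variable {P : Type*} [Fintype P] (r : P → P → Prop) {w : P → ℝ}

lemma rootedSum_smul (w : P → ℝ) (c : ℝ) (x : P) (k : ℕ) :
    rootedSum r (fun y => c * w y) x (Fin k) = c ^ k * rootedSum r w x (Fin k) := by
  unfold rootedSum
  rw [Finset.mul_sum]
  refine Finset.sum_congr rfl fun e _ => ?_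
  rw [Finset.prod_mul_distrib]
  simp
  ring

variable {r}

lemma sum_rootedSum_le (hr : ∀ a b, r a b → r b a) (hw : ∀ x, 0 ≤ w x)
    (hKP : ∀ x, (∑ y with r x y, w y) * Real.exp 1 ≤ 1) (N : ℕ) (x : P) :
    ∑ k ∈ range N, rootedSum r w x (Fin k) / k.factorial ≤ Real.exp 1 := by
  refine sum_range_le_exp_one (τ := fun x k => rootedSum r w x (Fin k) / k.factorial) hw
    (fun x k => div_nonneg (rootedSum_nonneg r w hw x) (Nat.cast_nonneg _))
    (fun x => by simp [rootedSum_zero]) (fun x k => ?_) hKP N x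
  have hk : ((k + 1).factorial : ℝ) = (k + 1) * k.factorial := by
    rw [Nat.factorial_succ]; push_cast; ring
  have hk0 : (0 : ℝ) < k.factorial := by exact_mod_cast k.factorial_pos
  have h1 : ((k : ℝ) + 1) * (rootedSum r w x (Fin (k + 1)) / (k + 1).factorial) =
      rootedSum r w x (Fin (k + 1)) / k.factorial := by
    rw [hk]; field_simp
  rw [h1, div_le_iff₀ hk0, Finset.sum_mul]
  refine (rootedSum_succ_le r w hr hw x k).trans (Finset.sum_le_sum fun j hj => ?_)
  have hjk : j ≤ k := by simpa [Nat.lt_succ_iff] using hj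
  have hc : (k.choose j : ℝ) * (j.factorial * (k - j).factorial) = k.factorial := by
    rw [← mul_assoc]
    exact_mod_cast Nat.choose_mul_factorial_mul_factorial hjk
  have hj0 : (0 : ℝ) < j.factorial := by exact_mod_cast j.factorial_pos
  have hkj0 : (0 : ℝ) < (k - j).factorial := by exact_mod_cast (k - j).factorial_pos
  have h2 : (∑ y with r x y, w y * (rootedSum r w y (Fin j) / j.factorial)) =
      (∑ y with r x y, w y * rootedSum r w y (Fin j)) / j.factorial := by
    rw [Finset.sum_div]
    exact Finset.sum_congr rfl fun y _ => by ring
  rw [h2, ← hc]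
  have h3 := mul_le_mul_of_nonneg_left (mul_le_mul_of_nonneg_right (touchSum_le r w hw x j)
    (rootedSum_nonneg r w hw x (ι := Fin (k - j)))) (Nat.cast_nonneg (α := ℝ) (k.choose j))
  refine h3.trans (le_of_eq ?_)
  field_simp

/-- Absolute convergence of the cluster expansion with an exponential weight. -/
lemma sum_abs_mayer_le (hr : ∀ a b, r a b → r b a) (hw : ∀ x, 0 ≤ w x)
    (hKP : ∀ x, (∑ y with r x y, w y) * Real.exp 2 ≤ 1) (N : ℕ) :
    ∑ k ∈ range N, (k + 1) * ((∑ e : Fin (k + 1) → P, |mayer r e| * ∏ i, w (e i)) /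
      (k + 1).factorial) * Real.exp (k + 1) ≤ Real.exp 2 * ∑ x, w x := by
  have h2 : Real.exp 2 = Real.exp 1 * Real.exp 1 := by rw [← Real.exp_add]; norm_num
  -- One of the two factors `exp 1` in `exp 2` tilts the weights and produces `exp (k + 1)`; the
  -- other one is used by the convergence criterion. The factor `k + 1` comes from rooting, as `1 /
  -- k! = (k + 1) / (k + 1)!`.
  have hw' : ∀ x, 0 ≤ Real.exp 1 * w x := fun x => mul_nonneg (Real.exp_pos 1).le (hw x)
  have hKP' : ∀ x, (∑ y with r x y, Real.exp 1 * w y) * Real.exp 1 ≤ 1 := by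
    intro x
    rw [← Finset.mul_sum]
    refine le_trans (le_of_eq ?_) (hKP x)
    rw [h2]; ring
  have h := fun x => sum_rootedSum_le hr hw' hKP' N x
  have key : ∑ k ∈ range N, (k + 1) * ((∑ e : Fin (k + 1) → P, |mayer r e| * ∏ i, w (e i)) /
      (k + 1).factorial) * Real.exp (k + 1) = ∑ x, Real.exp 1 * w x *
        ∑ k ∈ range N, rootedSum r (fun y => Real.exp 1 * w y) x (Fin k) / k.factorial := by
    simp_rw [Finset.mul_sum]
    rw [Finset.sum_comm]
    refine Finset.sum_congr rfl fun k _ => ?_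
    rw [sum_abs_mayer]
    have hk : ((k + 1).factorial : ℝ) = (k + 1) * k.factorial := by
      rw [Nat.factorial_succ]; push_cast; ring
    have hk0 : (0 : ℝ) < k.factorial := by exact_mod_cast k.factorial_pos
    have he : Real.exp ((k : ℝ) + 1) = Real.exp 1 ^ k * Real.exp 1 := by
      rw [Real.exp_add, ← Real.exp_nat_mul, mul_one]
    rw [hk, he, Finset.sum_div, Finset.mul_sum, Finset.sum_mul]
    refine Finset.sum_congr rfl fun y _ => ?_
    rw [rootedSum_smul]
    field_simp
  rw [key, h2, mul_assoc, Finset.mul_sum, Finset.mul_sum]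
  refine Finset.sum_le_sum fun x _ => ?_
  rw [show Real.exp 1 * (Real.exp 1 * w x) = Real.exp 1 * w x * Real.exp 1 by ring]
  exact mul_le_mul_of_nonneg_left (h x) (hw' x)

end Convergence

/-! ### From $Z' = L'Z$ to $Z = \exp L$. -/

section Exponential

open Finset

/-- If the coefficients of a polynomial `Z` and a series `L` satisfy `Z' = L' Z`, then
`Z = exp L` at `1`. -/
lemma sum_eq_exp_tsum {z l : ℕ → ℝ} {N : ℕ} (hzN : ∀ m, N < m → z m = 0) (hz0 : z 0 = 1)
    (hrec : ∀ k : ℕ, (k + 1) * z (k + 1) =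
      ∑ j ∈ range (k + 1), (j + 1) * l j * z (k - j))
    (hl : Summable fun j : ℕ => (j + 1) * |l j| * 2 ^ j) :
    ∑ m ∈ range (N + 1), z m = Real.exp (∑' j, l j) := by
  -- The interval has to contain 0 and 1 in its interior; radius 2 matches the factor `2 ^ j` in
  -- `hl`.
  set I : Set ℝ := Set.Ioo (-2) 2 with hI
  set Z : ℝ → ℝ := fun t => ∑ m ∈ range (N + 1), z m * t ^ m with hZ
  set L : ℝ → ℝ := fun t => ∑' j, l j * t ^ (j + 1) with hL
  have hbd : ∀ (j : ℕ) (t : ℝ), t ∈ I → ‖(j + 1) * l j * t ^ j‖ ≤ (j + 1) * |l j| * 2 ^ j := by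
    intro j t ht
    have ht2 : |t| ≤ 2 := abs_le.2 ⟨ht.1.le, ht.2.le⟩
    have h1 : |(j : ℝ) + 1| = j + 1 := abs_of_nonneg (by positivity)
    rw [Real.norm_eq_abs, abs_mul, abs_mul, abs_pow, h1]
    gcongr
  have hdL : ∀ t ∈ I, HasDerivAt L (∑' j : ℕ, (j + 1) * l j * t ^ j) t := by
    intro t ht
    refine hasDerivAt_tsum_of_isPreconnected hl isOpen_Ioo isPreconnected_Ioo
      (g := fun j t => l j * t ^ (j + 1)) (y₀ := 0) ?_ hbd ?_ ?_ ht
    · intro j y _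
      refine HasDerivAt.congr_deriv ((hasDerivAt_pow (j + 1) y).const_mul (l j)) ?_
      rw [Nat.add_sub_cancel]
      push_cast
      ring
    · constructor <;> norm_num
    · simp
  have hdZ : ∀ t, HasDerivAt Z (∑' k : ℕ, (k + 1) * z (k + 1) * t ^ k) t := by
    intro t
    have h : HasDerivAt Z (∑ k ∈ range (N + 1), z k * (k * t ^ (k - 1))) t :=
      HasDerivAt.fun_sum fun k _ => (hasDerivAt_pow k t).const_mul _
    rw [Finset.sum_range_succ'] at h
    convert h using 1
    rw [tsum_eq_sum (s := range N)]
    · simp only [Nat.cast_zero, zero_mul, mul_zero, add_zero, Nat.add_sub_cancel]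
      refine Finset.sum_congr rfl fun k _ => ?_
      push_cast
      ring
    · intro k hk
      rw [Finset.mem_range, not_lt] at hk
      rw [hzN (k + 1) (by omega)]
      ring
  -- The recursion `hrec` is the Cauchy product of the series of `L'` and `Z`.
  have hODE : ∀ t ∈ I, (∑' k : ℕ, (k + 1) * z (k + 1) * t ^ k) =
      (∑' j : ℕ, (j + 1) * l j * t ^ j) * Z t := by
    intro t ht
    have hZt : Z t = ∑' m, z m * t ^ m := by
      rw [tsum_eq_sum (s := range (N + 1))]
      intro m hm
      rw [Finset.mem_range, not_lt] at hm
      rw [hzN m (by omega), zero_mul]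
    rw [hZt, tsum_mul_tsum_eq_tsum_sum_range_of_summable_norm]
    · refine tsum_congr fun k => ?_
      rw [hrec, Finset.sum_mul]
      refine Finset.sum_congr rfl fun j hj => ?_
      have hjk : j ≤ k := by simpa [Nat.lt_succ_iff] using hj
      rw [← Nat.add_sub_cancel' hjk, pow_add, Nat.add_sub_cancel' hjk]
      ring
    · exact hl.of_nonneg_of_le (fun _ => norm_nonneg _) fun j => hbd j t ht
    · refine summable_of_ne_finset_zero (s := range (N + 1)) fun m hm => ?_
      rw [Finset.mem_range, not_lt] at hm
      rw [hzN m (by omega), zero_mul, norm_zero]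
  have hdF : ∀ t ∈ I, HasDerivAt (fun t => Z t * Real.exp (-L t)) 0 t := by
    intro t ht
    refine HasDerivAt.congr_deriv ((hdZ t).mul (hdL t ht).neg.exp) ?_
    rw [hODE t ht, Pi.neg_apply]
    generalize (∑' j : ℕ, ((j : ℝ) + 1) * l j * t ^ j) = D
    ring
  have h0 : (0 : ℝ) ∈ I := by constructor <;> norm_num
  have h1 : (1 : ℝ) ∈ I := by constructor <;> norm_num
  have hconst := isOpen_Ioo.is_const_of_deriv_eq_zero isPreconnected_Ioo
    (fun t ht => (hdF t ht).differentiableAt.differentiableWithinAt)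
    (fun t ht => (hdF t ht).deriv) h1 h0
  have hL0 : L 0 = 0 := by simp [hL]
  have hL1 : L 1 = ∑' j, l j := by simp [hL]
  have hZ0 : Z 0 = 1 := by
    simp only [hZ]
    rw [Finset.sum_range_succ']
    simp [hz0]
  have hZ1 : Z 1 = ∑ m ∈ range (N + 1), z m := by simp [hZ]
  simp only [hL0, hZ0, hL1, hZ1, neg_zero, Real.exp_zero, mul_one] at hconst
  rw [Real.exp_neg, ← div_eq_mul_inv, div_eq_one_iff_eq (Real.exp_pos _).ne'] at hconst
  exact hconst

end Exponential

/-! ### Cluster expansion of a general polymer model. -/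

section Polymer

open Classical Finset

variable {P : Type*} [Fintype P] (r : P → P → Prop) (w : P → ℝ)

/-- A finite set of pairwise compatible polymers. -/
def Compatible (M : Finset P) : Prop := ∀ x ∈ M, ∀ y ∈ M, x ≠ y → ¬ r x y

/-- The partition function of a polymer model. -/
noncomputable def polymerZ : ℝ := ∑ M : Finset P with Compatible r M, ∏ x ∈ M, w x

variable {r}

lemma card_tuples_of_image {m : ℕ} {M : Finset P} (hM : #M = m) :
    #{e : Fin m → P | Function.Injective e ∧ univ.image e = M} = m.factorial := by
  have h1 : #{e : Fin m → P | Function.Injective e ∧ univ.image e = M} =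
      Fintype.card (Fin m ≃ M) := by
    rw [← Finset.card_univ]
    symm
    refine Finset.card_bij (fun σ _ i => (σ i : P)) ?_ ?_ ?_
    · intro σ _
      simp only [mem_filter, mem_univ, true_and]
      refine ⟨Subtype.val_injective.comp σ.injective, ?_⟩
      ext x
      simp only [mem_image, mem_univ, true_and]
      constructor
      · rintro ⟨i, rfl⟩
        exact (σ i).2
      · intro hx
        exact ⟨σ.symm ⟨x, hx⟩, by simp⟩
    · intro σ _ τ _ h
      ext i
      exact congrFun h i
    · intro e he
      simp only [mem_filter, mem_univ, true_and] at he
      have hmem : ∀ i, e i ∈ M := fun i => he.2 ▸ mem_image_of_mem e (mem_univ i)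
      refine ⟨Equiv.ofBijective (fun i => ⟨e i, hmem i⟩) ⟨?_, ?_⟩, mem_univ _, rfl⟩
      · intro i j hij
        exact he.1 (congrArg Subtype.val hij)
      · rintro ⟨x, hx⟩
        rw [← he.2, mem_image] at hx
        obtain ⟨i, -, rfl⟩ := hx
        exact ⟨i, rfl⟩
  rw [h1, Fintype.card_equiv (M.equivFinOfCardEq hM).symm, Fintype.card_fin]

/-- Reflexivity of `r` forbids repetitions, so the surviving tuples are the `m!` enumerations of
each compatible set of size `m`. -/
lemma freeSum_eq_factorial_mul (hr : ∀ a b, r a b → r b a) (hrefl : ∀ a, r a a) (m : ℕ) :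
    freeSum r w (Fin m) =
      m.factorial * ∑ M : Finset P with Compatible r M ∧ #M = m, ∏ x ∈ M, w x := by
  have hspan : ∀ e : Fin m → P, spanSum (overlapGraph r e) univ =
      if Function.Injective e ∧ Compatible r (univ.image e) then 1 else 0 := by
    intro e
    rw [spanSum_eq]
    congr 1
    simp only [mem_univ, true_implies, overlapGraph_adj hr, Compatible, mem_image, true_and,
      eq_iff_iff]
    constructor
    · intro h
      have hinj : Function.Injective e := by
        intro i j hij
        by_contra hne
        exact h i j ⟨hne, hij ▸ hrefl _⟩
      refine ⟨hinj, ?_⟩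
      rintro _ ⟨i, rfl⟩ _ ⟨j, rfl⟩ hne hrr
      exact h i j ⟨fun hij => hne (hij ▸ rfl), hrr⟩
    · rintro ⟨hinj, h⟩ i j ⟨hne, hrr⟩
      exact h _ ⟨i, rfl⟩ _ ⟨j, rfl⟩ (hinj.ne hne) hrr
  unfold freeSum
  simp_rw [hspan, ite_mul, one_mul, zero_mul]
  rw [← Finset.sum_filter, Finset.mul_sum, ← Finset.sum_fiberwise_of_maps_to
    (t := {M : Finset P | Compatible r M ∧ #M = m}) (g := fun e : Fin m → P => univ.image e)]
  · refine Finset.sum_congr rfl fun M hM => ?_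
    simp only [mem_filter, mem_univ, true_and] at hM
    rw [Finset.sum_congr (g := fun _ => ∏ x ∈ M, w x)
      (s₂ := {e : Fin m → P | Function.Injective e ∧ univ.image e = M}), Finset.sum_const,
      card_tuples_of_image hM.2, nsmul_eq_mul]
    · ext e
      simp only [mem_filter, mem_univ, true_and]
      constructor
      · rintro ⟨⟨h1, -⟩, h2⟩
        exact ⟨h1, h2⟩
      · rintro ⟨h1, h2⟩
        exact ⟨⟨h1, h2 ▸ hM.1⟩, h2⟩
    · intro e he
      simp only [mem_filter, mem_univ, true_and] at he
      rw [← he.2, Finset.prod_image fun i _ j _ h => he.1 h]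
  · intro e he
    simp only [mem_filter, mem_univ, true_and] at he ⊢
    refine ⟨he.2, ?_⟩
    rw [card_image_of_injective _ he.1, card_univ, Fintype.card_fin]

/-- The `m`-th term of the cluster expansion. -/
noncomputable def clusterTerm (r : P → P → Prop) (w : P → ℝ) (m : ℕ) : ℝ :=
  ∑ e : Fin m → P, mayer r e / m.factorial * ∏ i, w (e i)

/-- The `m`-th absolute term of the cluster expansion. -/
noncomputable def absClusterTerm (r : P → P → Prop) (w : P → ℝ) (m : ℕ) : ℝ :=
  ∑ e : Fin m → P, |mayer r e / m.factorial * ∏ i, w (e i)|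

variable {w}

lemma abs_clusterTerm_le (m : ℕ) : |clusterTerm r w m| ≤ absClusterTerm r w m :=
  Finset.abs_sum_le_sum_abs _ _

lemma absClusterTerm_nonneg (m : ℕ) : 0 ≤ absClusterTerm r w m :=
  Finset.sum_nonneg fun _ _ => abs_nonneg _

lemma absClusterTerm_eq (hw : ∀ x, 0 ≤ w x) (m : ℕ) :
    absClusterTerm r w m =
      (∑ e : Fin m → P, |mayer r e| * ∏ i, w (e i)) / m.factorial := by
  rw [absClusterTerm, Finset.sum_div]
  refine Finset.sum_congr rfl fun e _ => ?_
  rw [abs_mul, abs_div, Nat.abs_cast, abs_of_nonneg (Finset.prod_nonneg fun i _ => hw (e i))]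
  ring

lemma summable_weighted (hr : ∀ a b, r a b → r b a) (hw : ∀ x, 0 ≤ w x)
    (hKP : ∀ x, (∑ y with r x y, w y) * Real.exp 2 ≤ 1) :
    Summable (fun k : ℕ => (k + 1) * absClusterTerm r w (k + 1) * Real.exp (k + 1)) ∧
      ∑' k : ℕ, (k + 1) * absClusterTerm r w (k + 1) * Real.exp (k + 1) ≤
        Real.exp 2 * ∑ x, w x := by
  have h0 : ∀ k : ℕ, 0 ≤ (k + 1) * absClusterTerm r w (k + 1) * Real.exp (k + 1) := fun k =>
    mul_nonneg (mul_nonneg (by positivity) (absClusterTerm_nonneg _)) (Real.exp_pos _).le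
  have h1 : ∀ N : ℕ, ∑ k ∈ range N, (k + 1) * absClusterTerm r w (k + 1) * Real.exp (k + 1) ≤
      Real.exp 2 * ∑ x, w x := by
    intro N
    simp_rw [absClusterTerm_eq hw]
    exact sum_abs_mayer_le hr hw hKP N
  exact ⟨summable_of_sum_range_le h0 h1, Real.tsum_le_of_sum_range_le h0 h1⟩

lemma summable_absClusterTerm (hr : ∀ a b, r a b → r b a) (hw : ∀ x, 0 ≤ w x)
    (hKP : ∀ x, (∑ y with r x y, w y) * Real.exp 2 ≤ 1) :
    Summable (fun k : ℕ => absClusterTerm r w (k + 1)) := by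
  refine (summable_weighted hr hw hKP).1.of_nonneg_of_le (fun k => absClusterTerm_nonneg _)
    fun k => ?_
  have h1 : (1 : ℝ) ≤ k + 1 := by linarith [Nat.cast_nonneg (α := ℝ) k]
  have h2 : 1 ≤ Real.exp ((k : ℝ) + 1) := Real.one_le_exp (by linarith)
  have h3 := absClusterTerm_nonneg (r := r) (w := w) (k + 1)
  nlinarith [mul_nonneg h3 (sub_nonneg.2 h1), mul_nonneg (mul_nonneg (by positivity) h3 :
    0 ≤ ((k : ℝ) + 1) * absClusterTerm r w (k + 1)) (sub_nonneg.2 h2)]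

/-- The coefficients `freeSum / m!` of the partition polynomial and the cluster terms satisfy $Z' =
L'Z$, and the exponentially weighted bound gives the convergence on radius 2, since `2 ≤ exp 1`. -/
lemma hasSum_clusterTerm (hr : ∀ a b, r a b → r b a) (hrefl : ∀ a, r a a) (hw : ∀ x, 0 ≤ w x)
    (hKP : ∀ x, (∑ y with r x y, w y) * Real.exp 2 ≤ 1) :
    HasSum (fun k : ℕ => clusterTerm r w (k + 1)) (Real.log (polymerZ r w)) := by
  set l : ℕ → ℝ := fun k => clusterTerm r w (k + 1) with hl
  set z : ℕ → ℝ := fun m => freeSum r w (Fin m) / m.factorial with hz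
  have hzeq : ∀ m, z m = ∑ M : Finset P with Compatible r M ∧ #M = m, ∏ x ∈ M, w x := by
    intro m
    have : (m.factorial : ℝ) ≠ 0 := by exact_mod_cast m.factorial_ne_zero
    simp only [hz]
    rw [freeSum_eq_factorial_mul w hr hrefl]
    field_simp
  have hl' : ∀ k, l k = mayerSum r w (Fin (k + 1)) / (k + 1).factorial := by
    intro k
    simp only [hl, clusterTerm, mayerSum]
    rw [Finset.sum_div]
    exact Finset.sum_congr rfl fun e _ => by ring
  have habs : ∀ k, |l k| ≤ absClusterTerm r w (k + 1) := fun k => abs_clusterTerm_le _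
  have hsum : Summable l := Summable.of_norm_bounded (summable_absClusterTerm hr hw hKP) habs
  have hexp : ∑ m ∈ range (Fintype.card P + 1), z m = Real.exp (∑' j, l j) := by
    refine sum_eq_exp_tsum ?_ ?_ ?_ ?_
    · intro m hm
      rw [hzeq]
      refine Finset.sum_eq_zero fun M hM => ?_
      simp only [mem_filter, mem_univ, true_and] at hM
      exact absurd (hM.2 ▸ card_le_univ M) (not_le.2 hm)
    · rw [hzeq]
      have : ({M : Finset P | Compatible r M ∧ #M = 0} : Finset (Finset P)) = {∅} := by
        ext M
        simp only [mem_filter, mem_univ, true_and, card_eq_zero, mem_singleton]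
        exact ⟨fun h => h.2, fun h => ⟨by rw [h]; simp [Compatible], h⟩⟩
      rw [this]
      simp
    · intro k
      have hk : ((k + 1).factorial : ℝ) = (k + 1) * k.factorial := by
        rw [Nat.factorial_succ]; push_cast; ring
      have hk0 : (0 : ℝ) < k.factorial := by exact_mod_cast k.factorial_pos
      have h1 : ((k : ℝ) + 1) * z (k + 1) = freeSum r w (Fin (k + 1)) / k.factorial := by
        simp only [hz]
        rw [hk]; field_simp
      rw [h1, freeSum_succ, Finset.sum_div]
      refine Finset.sum_congr rfl fun j hj => ?_
      have hjk : j ≤ k := by simpa [Nat.lt_succ_iff] using hj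
      have hc : (k.choose j : ℝ) * (j.factorial * (k - j).factorial) = k.factorial := by
        rw [← mul_assoc]
        exact_mod_cast Nat.choose_mul_factorial_mul_factorial hjk
      have hj0 : (0 : ℝ) < j.factorial := by exact_mod_cast j.factorial_pos
      have hkj0 : (0 : ℝ) < (k - j).factorial := by exact_mod_cast (k - j).factorial_pos
      have hch0 : (0 : ℝ) < k.choose j := by exact_mod_cast Nat.choose_pos hjk
      have hj1 : ((j + 1).factorial : ℝ) = (j + 1) * j.factorial := by
        rw [Nat.factorial_succ]; push_cast; ring
      rw [hl', ← hc, hj1]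
      simp only [hz]
      field_simp
    · refine (summable_weighted hr hw hKP).1.of_nonneg_of_le
        (fun k => by positivity) fun k => ?_
      have h2 : (2 : ℝ) ^ k ≤ Real.exp (k + 1) := by
        have h3 : (2 : ℝ) ≤ Real.exp 1 := by linarith [Real.add_one_le_exp (1 : ℝ)]
        calc (2 : ℝ) ^ k ≤ Real.exp 1 ^ k := pow_le_pow_left₀ (by norm_num) h3 k
          _ = Real.exp k := by rw [← Real.exp_nat_mul, mul_one]
          _ ≤ _ := Real.exp_le_exp.2 (by linarith)
      have := habs k
      have := absClusterTerm_nonneg (r := r) (w := w) (k + 1)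
      gcongr
  have hZ : ∑ m ∈ range (Fintype.card P + 1), z m = polymerZ r w := by
    unfold polymerZ
    rw [← Finset.sum_fiberwise_of_maps_to (t := range (Fintype.card P + 1))
      (g := fun M : Finset P => #M)
      (fun M _ => mem_range.2 (Nat.lt_succ_of_le (card_le_univ M)))]
    refine Finset.sum_congr rfl fun m _ => ?_
    rw [hzeq, Finset.filter_filter]
  rw [← hZ, hexp, Real.log_exp]
  exact hsum.hasSum

/-- Every omitted cluster has size at least `N + 1`, so the weighted bound gains a factor `exp (-(N
+ 1))`. -/
lemma abs_log_sub_le (hr : ∀ a b, r a b → r b a) (hrefl : ∀ a, r a a) (hw : ∀ x, 0 ≤ w x)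
    (hKP : ∀ x, (∑ y with r x y, w y) * Real.exp 2 ≤ 1) (N : ℕ) :
    |Real.log (polymerZ r w) - ∑ m ∈ Icc 1 N, clusterTerm r w m| ≤
      Real.exp (-(N + 1)) * (Real.exp 2 * ∑ x, w x) := by
  have h := hasSum_clusterTerm hr hrefl hw hKP
  have hN : ∑ m ∈ Icc 1 N, clusterTerm r w m = ∑ k ∈ range N, clusterTerm r w (k + 1) := by
    rw [Finset.range_eq_Ico, Finset.sum_Ico_add' (fun k => clusterTerm r w k) 0 N 1, zero_add]
    rfl
  obtain ⟨hs, hle⟩ := summable_weighted hr hw hKP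
  have hsub : Real.log (polymerZ r w) - ∑ k ∈ range N, clusterTerm r w (k + 1) =
      ∑' k, clusterTerm r w (k + N + 1) := by
    rw [← h.tsum_eq, ← h.summable.sum_add_tsum_nat_add N]
    ring
  have hs' := (summable_nat_add_iff N).2 hs
  have hbd : ∀ k : ℕ, ‖clusterTerm r w (k + N + 1)‖ ≤ Real.exp (-(N + 1)) *
      (((k + N : ℕ) + 1) * absClusterTerm r w (k + N + 1) * Real.exp ((k + N : ℕ) + 1)) := by
    intro k
    have h0 := absClusterTerm_nonneg (r := r) (w := w) (k + N + 1)
    have h1 : (1 : ℝ) ≤ Real.exp (-(N + 1)) * (((k + N : ℕ) + 1) * Real.exp ((k + N : ℕ) + 1)) := by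
      have h2 : Real.exp (-((N : ℝ) + 1)) * (((k + N : ℕ) + 1) * Real.exp ((k + N : ℕ) + 1)) =
          ((k + N : ℕ) + 1) * Real.exp k := by
        rw [mul_left_comm, ← Real.exp_add]
        congr 2
        push_cast
        ring
      rw [h2]
      have h3 : (1 : ℝ) ≤ (k + N : ℕ) + 1 := by linarith [Nat.cast_nonneg (α := ℝ) (k + N)]
      have h4 : 1 ≤ Real.exp (k : ℝ) := Real.one_le_exp (Nat.cast_nonneg k)
      exact one_le_mul_of_one_le_of_one_le h3 h4
    calc ‖clusterTerm r w (k + N + 1)‖ ≤ absClusterTerm r w (k + N + 1) := abs_clusterTerm_le _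
      _ ≤ absClusterTerm r w (k + N + 1) *
          (Real.exp (-(N + 1)) * (((k + N : ℕ) + 1) * Real.exp ((k + N : ℕ) + 1))) :=
        le_mul_of_one_le_right h0 h1
      _ = _ := by ring
  rw [hN, hsub, ← Real.norm_eq_abs]
  refine (tsum_of_norm_bounded (hs'.mul_left _).hasSum hbd).trans ?_
  rw [tsum_mul_left]
  refine mul_le_mul_of_nonneg_left (le_trans ?_ hle) (Real.exp_pos _).le
  rw [← hs.sum_add_tsum_nat_add N]
  exact le_add_of_nonneg_left (Finset.sum_nonneg fun k _ =>
    mul_nonneg (mul_nonneg (by positivity) (absClusterTerm_nonneg _)) (Real.exp_pos _).le)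

end Polymer

/-! ### Degrees of the binomial random graph. -/

section Random

open Classical Finset MeasureTheory

lemma degree_eq_card_filter {V : Type*} [Fintype V] (A : SimpleGraph V) [DecidableRel A.Adj] (v : V) :
    A.degree v = #{e ∈ A.edgeFinset | v ∈ e} := by
  rw [← SimpleGraph.card_incidenceFinset_eq_degree, SimpleGraph.incidenceFinset_eq_filter]

lemma binomialRandom_real_singleton {V : Type*} [Fintype V] (p : unitInterval)
    (A : SimpleGraph V) :
    (SimpleGraph.binomialRandom V p).real {A} =
      (p : ℝ) ^ #A.edgeFinset *
        (1 - p : ℝ) ^ #((⊤ : SimpleGraph V).edgeFinset \ A.edgeFinset) := by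
  have hsub : A.edgeFinset ⊆ (⊤ : SimpleGraph V).edgeFinset :=
    SimpleGraph.edgeFinset_mono le_top
  have h1 : A.edgeSet.ncard = #A.edgeFinset := by
    rw [← SimpleGraph.coe_edgeFinset, Set.ncard_coe_finset]
  rw [measureReal_def, SimpleGraph.binomialRandom_singleton, card_sdiff_of_subset hsub,
    SimpleGraph.card_edgeFinset_top_eq_card_choose_two, h1, Nat.card_eq_fintype_card]
  simp

/-- The exponential moment of a degree in a binomial random graph. -/
lemma sum_binomialRandom_two_pow_degree {V : Type*} [Fintype V] (p : unitInterval) (v : V) :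
    ∑ A : SimpleGraph V, (SimpleGraph.binomialRandom V p).real {A} * 2 ^ A.degree v =
      (1 + p : ℝ) ^ (⊤ : SimpleGraph V).degree v := by
  -- Independence of the edges: expanding the product of binomials over all edges gives one term per
  -- graph.
  have h : ∑ A : SimpleGraph V, (∏ e ∈ A.edgeFinset, ((p : ℝ) * if v ∈ e then 2 else 1)) *
      ∏ e ∈ (⊤ : SimpleGraph V).edgeFinset \ A.edgeFinset, (1 - p : ℝ) =
        ∏ e ∈ (⊤ : SimpleGraph V).edgeFinset, ((p * if v ∈ e then 2 else 1) + (1 - p : ℝ)) := by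
    have h1 := sum_le_eq_sum_powerset (⊤ : SimpleGraph V) (fun T =>
      (∏ e ∈ T, ((p : ℝ) * if v ∈ e then 2 else 1)) *
        ∏ e ∈ (⊤ : SimpleGraph V).edgeFinset \ T, (1 - p : ℝ))
    rw [Finset.filter_true_of_mem fun _ _ => le_top] at h1
    rw [h1, Finset.prod_add]
    congr!
  have h2 : ∀ A : SimpleGraph V, (SimpleGraph.binomialRandom V p).real {A} * 2 ^ A.degree v =
      (∏ e ∈ A.edgeFinset, ((p : ℝ) * if v ∈ e then 2 else 1)) *
      ∏ e ∈ (⊤ : SimpleGraph V).edgeFinset \ A.edgeFinset, (1 - p : ℝ) := by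
    intro A
    rw [binomialRandom_real_singleton, Finset.prod_mul_distrib, Finset.prod_const,
      Finset.prod_const, ← Finset.prod_filter, Finset.prod_const, degree_eq_card_filter]
    ring
  rw [Finset.sum_congr rfl fun A _ => h2 A, h, degree_eq_card_filter, ← Finset.prod_const,
    Finset.prod_filter]
  refine Finset.prod_congr rfl fun e _ => ?_
  split_ifs <;> ring

instance measurableSingletonClass_simpleGraph {V : Type*} [Countable V] :
    MeasurableSingletonClass (SimpleGraph V) where
  measurableSet_singleton A := by
    rw [← SimpleGraph.measurableEmbedding_edgeSet.measurableSet_image, Set.image_singleton]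
    exact MeasurableSet.singleton _

lemma binomialRandom_real_eq_sum {V : Type*} [Fintype V] (p : unitInterval)
    (S : Set (SimpleGraph V)) :
    (SimpleGraph.binomialRandom V p).real S =
      ∑ A : SimpleGraph V with A ∈ S, (SimpleGraph.binomialRandom V p).real {A} := by
  rw [sum_measureReal_singleton]
  congr 1
  ext A
  simp

/-- Chernoff's bound with base 2: the moment of `2 ^ degree` is at most $e^{nq}$, so the probability
is at most $e^{nq(1 - 2\log 2)}$. -/
lemma binomialRandom_degree_gt_le {V : Type*} [Fintype V] {n : ℕ} (hV : Fintype.card V = n)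
    (hn : 1 ≤ n) (q : unitInterval)
    (hq : 9 * Real.log n / n ≤ (q : ℝ)) (v : V) :
    (SimpleGraph.binomialRandom V q).real {A | 2 * (n * (q : ℝ)) < A.degree v} ≤
      1 / (n : ℝ) ^ 2 := by
  have hn0 : (0 : ℝ) < n := by exact_mod_cast hn
  have hq0 : (0 : ℝ) ≤ q := q.2.1
  set c : ℝ := Real.exp (-(2 * (n * q) * Real.log 2)) with hc
  have h1 : (SimpleGraph.binomialRandom V q).real {A | 2 * (n * (q : ℝ)) < A.degree v} ≤
      c * ∑ A : SimpleGraph V,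
        (SimpleGraph.binomialRandom V q).real {A} * 2 ^ A.degree v := by
    rw [binomialRandom_real_eq_sum, Finset.mul_sum]
    refine (Finset.sum_le_sum fun A hA => ?_).trans
      (Finset.sum_le_sum_of_subset_of_nonneg (Finset.filter_subset _ _) fun A _ _ => ?_)
    · simp only [mem_filter, mem_univ, true_and, Set.mem_ofPred_eq] at hA
      have h2 : (1 : ℝ) ≤ c * 2 ^ A.degree v := by
        have h3 : (2 : ℝ) ^ A.degree v = Real.exp (A.degree v * Real.log 2) := by
          rw [Real.exp_nat_mul, Real.exp_log two_pos]
        rw [h3, hc, ← Real.exp_add]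
        refine Real.one_le_exp ?_
        have := mul_le_mul_of_nonneg_right hA.le (Real.log_pos one_lt_two).le
        linarith
      calc _ ≤ (SimpleGraph.binomialRandom V q).real {A} * (c * 2 ^ A.degree v) :=
            le_mul_of_one_le_right measureReal_nonneg h2
        _ = _ := by ring
    · exact mul_nonneg (Real.exp_pos _).le (mul_nonneg measureReal_nonneg (by positivity))
  refine h1.trans ?_
  rw [sum_binomialRandom_two_pow_degree]
  have h4 : (1 + q : ℝ) ^ (⊤ : SimpleGraph V).degree v ≤ Real.exp (n * q) := by
    have h5 : (⊤ : SimpleGraph V).degree v ≤ n := by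
      have := (⊤ : SimpleGraph V).degree_lt_card_verts v
      rw [hV] at this
      exact this.le
    calc (1 + q : ℝ) ^ (⊤ : SimpleGraph V).degree v ≤ (1 + q : ℝ) ^ n :=
          pow_le_pow_right₀ (by linarith) h5
      _ ≤ Real.exp q ^ n :=
          pow_le_pow_left₀ (by linarith) (by linarith [Real.add_one_le_exp (q : ℝ)]) n
      _ = Real.exp (n * q) := (Real.exp_nat_mul _ _).symm
  refine (mul_le_mul_of_nonneg_left h4 (Real.exp_pos _).le).trans ?_
  have h6 : 1 / (n : ℝ) ^ 2 = Real.exp (-(2 * Real.log n)) := by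
    rw [Real.exp_neg, two_mul, Real.exp_add, Real.exp_log hn0, sq, one_div]
  rw [h6, ← Real.exp_add]
  refine Real.exp_le_exp.2 ?_
  rw [div_le_iff₀ hn0] at hq
  have h7 := Real.log_two_gt_d9
  have h8 : 0 ≤ Real.log n := Real.log_nonneg (by exact_mod_cast hn)
  -- Here $2\log 2 - 1 > 0.386$ and $nq \ge 9\log n$, while $9 \cdot 0.386 > 2$.
  nlinarith [mul_nonneg (mul_nonneg hn0.le hq0) (sub_nonneg.2 h7.le)]

/-- Degrees in a binomial random graph of logarithmic expected degree are at most twice the mean,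
with high probability. -/
lemma binomialRandom_degree_le {V : Type*} [Fintype V] {n : ℕ} (hV : Fintype.card V = n)
    (hn : 1 ≤ n) (q : unitInterval)
    (hq : 9 * Real.log n / n ≤ (q : ℝ)) :
    1 - 1 / (n : ℝ) ≤ (SimpleGraph.binomialRandom V q).real
      {A | ∀ v, (A.degree v : ℝ) ≤ 2 * (n * (q : ℝ))} := by
  have hn0 : (0 : ℝ) < n := by exact_mod_cast hn
  have hcompl : {A : SimpleGraph V | ∀ v, (A.degree v : ℝ) ≤ 2 * (n * (q : ℝ))}ᶜ =
      ⋃ v, {A | 2 * (n * (q : ℝ)) < A.degree v} := by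
    ext A
    simp
  have hmeas : MeasurableSet
      {A : SimpleGraph V | ∀ v, (A.degree v : ℝ) ≤ 2 * (n * (q : ℝ))} :=
    (Set.toFinite _).measurableSet
  have h1 := probReal_compl_eq_one_sub (μ := SimpleGraph.binomialRandom V q) hmeas
  have h2 : (SimpleGraph.binomialRandom V q).real
      (⋃ v, {A | 2 * (n * (q : ℝ)) < A.degree v}) ≤ 1 / n := by
    refine (measureReal_iUnion_fintype_le _).trans ?_
    refine (Finset.sum_le_sum fun v _ => binomialRandom_degree_gt_le hV hn q hq v).trans (le_of_eq ?_)
    rw [Finset.sum_const, card_univ, hV, nsmul_eq_mul]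
    field_simp
  rw [hcompl] at h1
  linarith

end Random

/-! ### Application to matchings. -/

section MonomerDimer

open Classical Finset MonomerDimer

variable {n : ℕ}

/-- Two edges of `K_n` are incompatible when they have a common endpoint. -/
def Meets (x y : KnEdge n) : Prop := ∃ v, v ∈ (x : Sym2 (Fin n)) ∧ v ∈ (y : Sym2 (Fin n))

lemma Meets.symm (x y : KnEdge n) (h : Meets x y) : Meets y x :=
  h.imp fun _ hv => ⟨hv.2, hv.1⟩

lemma Meets.refl (x : KnEdge n) : Meets x x :=
  ⟨_, Sym2.out_fst_mem _, Sym2.out_fst_mem _⟩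

/-- The weight `z * A_e` of the edge `e`. -/
noncomputable def edgeWeight (A : SimpleGraph (Fin n)) (z : ℝ) (x : KnEdge n) : ℝ :=
  z * adjEntry A x

lemma incompatibilityGraph_eq {m : ℕ} (e : Fin m → KnEdge n) :
    incompatibilityGraph e = overlapGraph Meets e := by
  ext i j
  rw [overlapGraph_adj Meets.symm]
  rfl

lemma ursell_incompatibilityGraph {m : ℕ} (e : Fin m → KnEdge n) :
    ursell (incompatibilityGraph e) = mayer Meets e / m.factorial := by
  rw [ursell_eq, incompatibilityGraph_eq, mayer]

lemma adjEntry_nonneg (A : SimpleGraph (Fin n)) (x : KnEdge n) : 0 ≤ adjEntry A x := by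
  unfold adjEntry
  split_ifs <;> norm_num

lemma adjEntry_top (x : KnEdge n) : adjEntry (⊤ : SimpleGraph (Fin n)) x = 1 := if_pos x.2

lemma prod_edgeWeight (A : SimpleGraph (Fin n)) (z : ℝ) (M : Finset (KnEdge n)) :
    ∏ x ∈ M, edgeWeight A z x =
      if ∀ x ∈ M, (x : Sym2 (Fin n)) ∈ A.edgeSet then z ^ #M else 0 := by
  split_ifs with h
  · rw [← Finset.prod_const]
    exact Finset.prod_congr rfl fun x hx => by simp [edgeWeight, adjEntry, h x hx]
  · push Not at h
    obtain ⟨x, hx, hxA⟩ := h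
    exact Finset.prod_eq_zero hx (by simp [edgeWeight, adjEntry, hxA])

/-- Edges outside `A` have weight 0, so one polymer set, the edges of $K_n$, serves for every graph.
-/
lemma polymerZ_eq_partitionFunction (A : SimpleGraph (Fin n)) (z : ℝ) :
    polymerZ Meets (edgeWeight A z) = partitionFunction A z := by
  unfold polymerZ partitionFunction
  simp_rw [prod_edgeWeight]
  rw [← Finset.sum_filter, Finset.filter_filter]
  refine Finset.sum_bij (fun M _ => M.map (Function.Embedding.subtype _)) ?_ ?_ ?_ ?_
  · intro M hM
    simp only [mem_filter, mem_univ, true_and] at hM ⊢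
    constructor
    · intro e he
      rw [mem_map] at he
      obtain ⟨x, hx, rfl⟩ := he
      exact hM.2 x hx
    · intro e he f hf hef
      rw [mem_map] at he hf
      obtain ⟨x, hx, rfl⟩ := he
      obtain ⟨y, hy, rfl⟩ := hf
      exact hM.1 x hx y hy fun h => hef (h ▸ rfl)
  · intro M _ M' _ h
    exact Finset.map_injective _ h
  · intro M hM
    simp only [mem_filter, mem_univ, true_and] at hM
    have hmem : ∀ e ∈ M, e ∈ (⊤ : SimpleGraph (Fin n)).edgeSet := fun e he =>
      SimpleGraph.edgeSet_mono le_top (hM.1 e he)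
    refine ⟨M.subtype _, ?_, Finset.subtype_map_of_mem hmem⟩
    simp only [mem_filter, mem_univ, true_and, mem_subtype]
    refine ⟨fun x hx y hy hxy => ?_, fun x hx => hM.1 x hx⟩
    rw [mem_subtype] at hx hy
    exact hM.2 x hx y hy fun h => hxy (Subtype.ext h)
  · intro M _
    rw [card_map]

lemma edgeWeight_nonneg (A : SimpleGraph (Fin n)) {z : ℝ} (hz : 0 ≤ z) (x : KnEdge n) :
    0 ≤ edgeWeight A z x := mul_nonneg hz (adjEntry_nonneg A x)

lemma sum_edgeWeight_le_degree (A : SimpleGraph (Fin n)) {z : ℝ} (hz : 0 ≤ z) (v : Fin n) :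
    ∑ y : KnEdge n with v ∈ y.1, edgeWeight A z y ≤ z * A.degree v := by
  unfold edgeWeight adjEntry
  rw [← Finset.mul_sum, ← Finset.sum_filter, Finset.filter_filter, Finset.sum_const, nsmul_eq_mul,
    mul_one]
  refine mul_le_mul_of_nonneg_left ?_ hz
  rw [degree_eq_card_filter]
  refine Nat.cast_le.2 (card_le_card_of_injOn Subtype.val ?_ Subtype.val_injective.injOn)
  intro y hy
  simp only [coe_filter, mem_univ, true_and, Set.mem_ofPred_eq] at hy ⊢
  exact ⟨SimpleGraph.mem_edgeFinset.2 hy.2, hy.1⟩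

/-- The cluster expansion of the monomer-dimer model on a graph of small degrees. -/
lemma clusterExpansion_of_degree_le (hn : 1 ≤ n) (A : SimpleGraph (Fin n)) {z : ℝ} (hz : 0 ≤ z)
    (hd : ∀ v, z * A.degree v * Real.exp 2 ≤ 1 / 2) :
    (Summable fun m : ℕ => absClusterTerm Meets (edgeWeight A z) (m + 1)) ∧
      HasSum (fun m : ℕ => clusterTerm Meets (edgeWeight A z) (m + 1))
        (Real.log (partitionFunction A z)) ∧
      |Real.log (partitionFunction A z) -
        ∑ m ∈ Icc 1 ⌊2 * Real.log n⌋₊, clusterTerm Meets (edgeWeight A z) m| ≤ 1 / (n : ℝ) := by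
  have hn0 : (0 : ℝ) < n := by exact_mod_cast hn
  have hw := edgeWeight_nonneg A hz
  have he2 : 0 < Real.exp 2 := Real.exp_pos 2
  have hD : ∀ v, (∑ y : KnEdge n with v ∈ y.1, edgeWeight A z y) * Real.exp 2 ≤
      1 / 2 := fun v =>
    (mul_le_mul_of_nonneg_right (sum_edgeWeight_le_degree A hz v) he2.le).trans (hd v)
  -- An edge meeting `s(a, b)` contains `a` or `b`, and each endpoint contributes at most `1 / 2`.
  have hKP : ∀ x : KnEdge n, (∑ y with Meets x y, edgeWeight A z y) * Real.exp 2 ≤ 1 := by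
    rintro ⟨x, hx⟩
    induction x using Sym2.ind with
    | _ a b =>
      have h : ∑ y with Meets ⟨s(a, b), hx⟩ y, edgeWeight A z y ≤
          ∑ y : KnEdge n with a ∈ y.1, edgeWeight A z y +
            ∑ y : KnEdge n with b ∈ y.1, edgeWeight A z y := by
        rw [Finset.sum_filter, Finset.sum_filter, Finset.sum_filter, ← Finset.sum_add_distrib]
        refine Finset.sum_le_sum fun y _ => ?_
        have hy := hw y
        by_cases ha : a ∈ (y : Sym2 (Fin n))
        · rw [if_pos ha]
          split_ifs <;> linarith
        by_cases hb : b ∈ (y : Sym2 (Fin n))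
        · rw [if_pos hb]
          split_ifs <;> linarith
        have : ¬ Meets ⟨s(a, b), hx⟩ y := by
          rintro ⟨v, hv, hvy⟩
          rcases Sym2.mem_iff.1 hv with rfl | rfl
          · exact ha hvy
          · exact hb hvy
        rw [if_neg this, if_neg ha, if_neg hb, add_zero]
      refine (mul_le_mul_of_nonneg_right h he2.le).trans ?_
      linarith [hD a, hD b]
  -- Every edge is counted at one of its endpoints at least, and each of the `n` vertices
  -- contributes at most `1 / 2`.
  have htotal : Real.exp 2 * ∑ x, edgeWeight A z x ≤ n / 2 := by
    have h : ∑ x, edgeWeight A z x ≤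
        ∑ v, ∑ y : KnEdge n with v ∈ y.1, edgeWeight A z y := by
      simp_rw [Finset.sum_filter]
      rw [Finset.sum_comm]
      refine Finset.sum_le_sum fun y _ => ?_
      refine le_trans ?_ (Finset.single_le_sum (fun v _ => ?_)
        (mem_univ (Quot.out (y : Sym2 (Fin n))).1))
      · rw [if_pos (Sym2.out_fst_mem _)]
      · have := hw y
        split_ifs <;> linarith
    calc Real.exp 2 * ∑ x, edgeWeight A z x
        ≤ Real.exp 2 * ∑ v, ∑ y : KnEdge n with v ∈ y.1, edgeWeight A z y :=
          mul_le_mul_of_nonneg_left h he2.le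
      _ = ∑ v, (∑ y : KnEdge n with v ∈ y.1, edgeWeight A z y) * Real.exp 2 := by
          rw [mul_comm, Finset.sum_mul]
      _ ≤ ∑ _v : Fin n, (1 / 2 : ℝ) := Finset.sum_le_sum fun v _ => hD v
      _ = n / 2 := by simp [div_eq_mul_inv]
  refine ⟨summable_absClusterTerm Meets.symm hw hKP, ?_, ?_⟩
  · rw [← polymerZ_eq_partitionFunction]
    exact hasSum_clusterTerm Meets.symm Meets.refl hw hKP
  · rw [← polymerZ_eq_partitionFunction]
    refine (abs_log_sub_le Meets.symm Meets.refl hw hKP _).trans ?_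
    -- The first omitted size `⌊2 log n⌋ + 1` exceeds `2 log n`, which yields $n^{-2}$ against the
    -- total weight `n / 2`.
    have h1 : Real.exp (-((⌊2 * Real.log n⌋₊ : ℝ) + 1)) ≤ 1 / (n : ℝ) ^ 2 := by
      have h2 := Nat.lt_floor_add_one (2 * Real.log n)
      calc Real.exp (-((⌊2 * Real.log n⌋₊ : ℝ) + 1)) ≤ Real.exp (-(2 * Real.log n)) :=
            Real.exp_le_exp.2 (by linarith)
        _ = 1 / (n : ℝ) ^ 2 := by
            rw [Real.exp_neg, two_mul, Real.exp_add, Real.exp_log hn0, sq, one_div]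
    calc _ ≤ 1 / (n : ℝ) ^ 2 * (n / 2) :=
          mul_le_mul h1 htotal (mul_nonneg he2.le (Finset.sum_nonneg fun x _ => hw x))
            (by positivity)
      _ = 1 / n / 2 := by field_simp
      _ ≤ 1 / n := half_le_self (by positivity)

lemma ursell_mul_eq (A : SimpleGraph (Fin n)) (lam p : ℝ) {m : ℕ} (e : Fin m → KnEdge n) :
    ursell (incompatibilityGraph e) * (lam ^ m / p ^ m) * ∏ j, adjEntry A (e j) =
      mayer Meets e / m.factorial * ∏ j, edgeWeight A (lam / p) (e j) := by
  simp only [edgeWeight]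
  rw [ursell_incompatibilityGraph, Finset.prod_mul_distrib, Finset.prod_const, card_univ,
    Fintype.card_fin, div_pow, mul_assoc]

lemma ursell_mul_pow_eq (lam : ℝ) {m : ℕ} (e : Fin m → KnEdge n) :
    ursell (incompatibilityGraph e) * lam ^ m =
      mayer Meets e / m.factorial * ∏ j, edgeWeight (⊤ : SimpleGraph (Fin n)) lam (e j) := by
  simp only [edgeWeight, adjEntry_top]
  rw [ursell_incompatibilityGraph, mul_one, Finset.prod_const, card_univ, Fintype.card_fin]

lemma exp_two_le : Real.exp 2 ≤ 7.3891 := by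
  have h := Real.exp_one_lt_d9
  have h2 : Real.exp 2 = Real.exp 1 * Real.exp 1 := by rw [← Real.exp_add]; norm_num
  rw [h2]
  nlinarith [Real.exp_pos 1]

lemma clusterExpansion_completeGraph (hn : 1 ≤ n) {lam : ℝ} (hlam : 0 ≤ lam)
    (hle : lam ≤ 1 / (30 * (n : ℝ))) :
    (Summable fun m : ℕ => ∑ e : Fin (m + 1) → KnEdge n,
        |ursell (incompatibilityGraph e) * lam ^ (m + 1)|) ∧
      HasSum (fun m : ℕ => ∑ e : Fin (m + 1) → KnEdge n,
          ursell (incompatibilityGraph e) * lam ^ (m + 1))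
        (Real.log (partitionFunction (⊤ : SimpleGraph (Fin n)) lam)) ∧
      |Real.log (partitionFunction (⊤ : SimpleGraph (Fin n)) lam) -
          ∑ m ∈ Icc 1 ⌊2 * Real.log n⌋₊, ∑ e : Fin m → KnEdge n,
            ursell (incompatibilityGraph e) * lam ^ m| ≤ 1 / (n : ℝ) := by
  have hn0 : (0 : ℝ) < n := by exact_mod_cast hn
  have he := exp_two_le
  have hdeg : ∀ (A : SimpleGraph (Fin n)) (v : Fin n), lam * A.degree v ≤ 1 / 30 := by
    intro A v
    have h1 : (A.degree v : ℝ) ≤ n := by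
      have := A.degree_lt_card_verts v
      rw [Fintype.card_fin] at this
      exact_mod_cast this.le
    calc lam * A.degree v ≤ 1 / (30 * n) * n := by gcongr
      _ = 1 / 30 := by field_simp
  have h := clusterExpansion_of_degree_le hn (⊤ : SimpleGraph (Fin n)) hlam fun v => by
    refine (mul_le_mul (hdeg ⊤ v) he (Real.exp_pos 2).le (by norm_num)).trans ?_
    norm_num
  simp only [ursell_mul_pow_eq]
  exact h

lemma clusterExpansion_weighted (hn : 1 ≤ n) (A : SimpleGraph (Fin n)) {lam p q : ℝ}
    (hlam : 0 ≤ lam) (hp : 0 < p) (hle : lam ≤ 1 / (30 * (n : ℝ))) (hqp : q ≤ 1.01 * p)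
    (hd : ∀ v, (A.degree v : ℝ) ≤ 2 * (n * q)) :
    (Summable fun m : ℕ => ∑ e : Fin (m + 1) → KnEdge n,
        |ursell (incompatibilityGraph e) * (lam ^ (m + 1) / p ^ (m + 1)) *
          ∏ j, adjEntry A (e j)|) ∧
      HasSum (fun m : ℕ => ∑ e : Fin (m + 1) → KnEdge n,
          ursell (incompatibilityGraph e) * (lam ^ (m + 1) / p ^ (m + 1)) *
            ∏ j, adjEntry A (e j))
        (Real.log (partitionFunction A (lam / p))) ∧
      |Real.log (partitionFunction A (lam / p)) -
          ∑ m ∈ Icc 1 ⌊2 * Real.log n⌋₊, ∑ e : Fin m → KnEdge n,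
            ursell (incompatibilityGraph e) * (lam ^ m / p ^ m) *
              ∏ j, adjEntry A (e j)| ≤ 1 / (n : ℝ) := by
  have hn0 : (0 : ℝ) < n := by exact_mod_cast hn
  have he := exp_two_le
  have h := clusterExpansion_of_degree_le hn A (div_nonneg hlam hp.le) fun v => by
    -- The constant is $\frac{1}{30np}\cdot 2n\cdot 1.01p$. Multiplied by $e^2 \le 7.3891$ it is
    -- about 0.4976, just below the required `1 / 2`; this is where 30 and 1.01 are used up.
    have h1 : lam / p * A.degree v ≤ 2.02 / 30 := by
      calc lam / p * A.degree v ≤ 1 / (30 * n) / p * (2 * (n * (1.01 * p))) := by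
            gcongr
            exact (hd v).trans (by gcongr)
        _ = 2.02 / 30 := by field_simp; norm_num
    calc _ ≤ (2.02 / 30 : ℝ) * 7.3891 := by gcongr
      _ ≤ 1 / 2 := by norm_num
  simp only [ursell_mul_eq]
  exact h

end MonomerDimer

end ClusterExpansion

theorem theorem3p3 (n : ℕ) (hn : 1 ≤ n) (lam p q : ℝ) (hlam : 0 < lam)
    (hp0 : 0 < p) (hp1 : p < 1) (hq0 : 0 < q) (hq1 : q < 1)
    (hlam_le : lam ≤ 1 / (30 * (n : ℝ)))
    (hq_ge : 9 * Real.log n / n ≤ q) (hq_le : q ≤ 1.01 * p) :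
    ((Summable fun m : ℕ => ∑ e : Fin (m + 1) → MonomerDimer.KnEdge n,
        |MonomerDimer.ursell (MonomerDimer.incompatibilityGraph e) * lam ^ (m + 1)|) ∧
      HasSum (fun m : ℕ => ∑ e : Fin (m + 1) → MonomerDimer.KnEdge n,
          MonomerDimer.ursell (MonomerDimer.incompatibilityGraph e) * lam ^ (m + 1))
        (Real.log (MonomerDimer.partitionFunction (⊤ : SimpleGraph (Fin n)) lam)) ∧
      |Real.log (MonomerDimer.partitionFunction (⊤ : SimpleGraph (Fin n)) lam) -
          ∑ m ∈ Finset.Icc 1 ⌊2 * Real.log n⌋₊, ∑ e : Fin m → MonomerDimer.KnEdge n,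
            MonomerDimer.ursell (MonomerDimer.incompatibilityGraph e) * lam ^ m| ≤ 1 / (n : ℝ)) ∧
    1 - 1 / (n : ℝ) ≤
      (SimpleGraph.binomialRandom (Fin n) ⟨q, hq0.le, hq1.le⟩).real
        {A : SimpleGraph (Fin n) |
          (Summable fun m : ℕ => ∑ e : Fin (m + 1) → MonomerDimer.KnEdge n,
            |MonomerDimer.ursell (MonomerDimer.incompatibilityGraph e) *
              (lam ^ (m + 1) / p ^ (m + 1)) * ∏ j, MonomerDimer.adjEntry A (e j)|) ∧
          HasSum (fun m : ℕ => ∑ e : Fin (m + 1) → MonomerDimer.KnEdge n,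
              MonomerDimer.ursell (MonomerDimer.incompatibilityGraph e) *
                (lam ^ (m + 1) / p ^ (m + 1)) * ∏ j, MonomerDimer.adjEntry A (e j))
            (Real.log (MonomerDimer.partitionFunction A (lam / p))) ∧
          |Real.log (MonomerDimer.partitionFunction A (lam / p)) -
              ∑ m ∈ Finset.Icc 1 ⌊2 * Real.log n⌋₊, ∑ e : Fin m → MonomerDimer.KnEdge n,
                MonomerDimer.ursell (MonomerDimer.incompatibilityGraph e) *
                  (lam ^ m / p ^ m) * ∏ j, MonomerDimer.adjEntry A (e j)| ≤ 1 / (n : ℝ)} := by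
  refine ⟨ClusterExpansion.clusterExpansion_completeGraph hn hlam.le hlam_le, ?_⟩
  refine (ClusterExpansion.binomialRandom_degree_le (Fintype.card_fin n) hn
    ⟨q, hq0.le, hq1.le⟩ hq_ge).trans (MeasureTheory.measureReal_mono fun A hA => ?_)
  exact ClusterExpansion.clusterExpansion_weighted hn A hlam.le hp0 hlam_le hq_le hA
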